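/- Let $\phi_1>0$ and $0<\phi_2<1$, and let $X$ be a Gaussian intrinsic random function of order $0$ on $\mathbb R^2$ with generalized covariance $K_{\phi_1,\phi_2}(h)=\phi_1\Gamma(-\phi_2)\|h\|^{2\phi_2}$; that is, every finite linear combination $\sum_u c_uX(x_u)$ with $\sum_u c_u=0$ is Gaussian with mean $0$ and variance $\sum_{u,v}c_uc_vK_{\phi_1,\phi_2}(x_u-x_v)$. The field is observed on the grid $\Lambda_n=\{0,\dots,n-1\}^2$; put $N=n^2$. For $r\in\{1,2\}$ and $n>2r$ let $$(D_{[r]}X)_t=X_t-X_{t+re_1}-X_{t+re_2}+X_{t+re_1+re_2},\qquad Q_r=\frac1{|\Lambda_{n-2r}|}\sum_{t\in\Lambda_{n-2r}}\bigl(D_{[r]}X_t\bigr)^2,$$ where $e_1=(1,0)$, $e_2=(0,1)$, and, for $n\ge5$ and $a_1(\phi)=|\Gamma(-\phi)|\,(8-4\cdot2^{\phi})$, $$\widehat\phi_2=\tfrac12\log_2(Q_2/Q_1),\qquad \widehat\phi_1=Q_1/a_1(\widehat\phi_2)$$ (with an undefined $\widehat\phi_1$ or $\widehat\phi_2$ replaced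 by $0$). Then $q_r=\mathbb E[Q_r]$ is finite and does not depend on $n$, for $r=1,2$. Let $$h(y_1,y_2)=\Bigl(\frac{y_1}{a_1(\frac12\log_2(y_2/y_1))},\ \tfrac12\log_2(y_2/y_1)\Bigr),$$ which is differentiable at $(q_1,q_2)$, and let $J$ be its Jacobian matrix at $(q_1,q_2)$. For $\lambda\in\mathbb R^2$ let $$f_0(\lambda)=2^{2\phi_2+2}\,\pi\,\Gamma(1+\phi_2)\,\phi_1\,\|\lambda\|^{-(2+2\phi_2)},\qquad f_X(\lambda)=\sum_{m\in\mathbb Z^2}f_0(\lambda+2\pi m),$$ $$f_D(\lambda)=\bigl|(1-e^{i\lambda_1})(1-e^{i\lambda_2})\bigr|^2f_X(\lambda),\qquad b_1(\lambda)=1,\qquad b_2(\lambda)=16\cos^2\tfrac{\lambda_1}2\cos^2\tfrac{\lambda_2}2 .$$ Let $\Sigma$ be the $2\times2$ matrix with (finite) entries $$\Sigma_{\ell m}=\frac{2}{(2\pi)^{2}}\int_{(-\pi,\pi]^2}b_\ell(\lambda)\,b_m(\lambda)\,f_D(\lambda)^2\,d\lambda .$$ Then, as $n\to\infty$, $$\sqrt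 N\begin{pmatrix}\widehat\phi_1/\phi_1-1\\ \widehat\phi_2-\phi_2\end{pmatrix}\ \Rightarrow\ \mathcal N\bigl(0,\ K\,\Sigma_h\,K^{\top}\bigr),\qquad K=\begin{pmatrix}1/\phi_1&0\\0&1\end{pmatrix},\qquad \Sigma_h=J\,\Sigma\,J^{\top}.$$ -/

import Mathlib

open MeasureTheory ProbabilityTheory Filter Topology

noncomputable section

namespace PowerLaw

/-- The plane `ℝ²` with its Euclidean norm. -/
abbrev Plane : Type := EuclideanSpace ℝ (Fin 2)

/-- The power-law generalized covariance `K(h) = φ₁ Γ(-φ₂) ‖h‖^(2 φ₂)`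
(for `φ₂` not an integer). -/
def genCov (φ₁ φ₂ : ℝ) (h : Plane) : ℝ :=
  φ₁ * Real.Gamma (-φ₂) * ‖h‖ ^ (2 * φ₂)

/-- A Gaussian intrinsic random function of order `0` on `ℝ²` with power-law generalized
covariance: every linear combination `∑ c(x) X(x)` with `∑ c(x) = 0` is Gaussian with mean zero
and variance `∑ ∑ c(x) c(y) K(x - y)`. -/
structure IsPowerLawField {Ω : Type*} [MeasurableSpace Ω] (P : Measure Ω)
    (X : Plane → Ω → ℝ) (φ₁ φ₂ : ℝ) : Prop where
  aemeasurable : ∀ x, AEMeasurable (X x) P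
  gaussian : ∀ (s : Finset Plane) (c : Plane → ℝ), ∑ x ∈ s, c x = 0 →
    HasGaussianLaw (fun ω => ∑ x ∈ s, c x * X x ω) P
  mean_zero : ∀ (s : Finset Plane) (c : Plane → ℝ), ∑ x ∈ s, c x = 0 →
    ∫ ω, ∑ x ∈ s, c x * X x ω ∂P = 0
  variance : ∀ (s : Finset Plane) (c : Plane → ℝ), ∑ x ∈ s, c x = 0 →
    variance (fun ω => ∑ x ∈ s, c x * X x ω) P =
      ∑ x ∈ s, ∑ y ∈ s, c x * c y * genCov φ₁ φ₂ (x - y)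

/-! ### Statistics of a field sampled on the integer lattice -/

/-- The grid `Λ_k = {0, …, k-1}²`. -/
def grid (k : ℕ) : Finset (ℕ × ℕ) := Finset.range k ×ˢ Finset.range k

/-- The values of a realization at the integer lattice points. -/
def sample (x : Plane → ℝ) (t : ℕ × ℕ) : ℝ := x !₂[(t.1 : ℝ), (t.2 : ℝ)]

/-- The bilinear difference at step `r`:
`x(t) - x(t + r e₁) - x(t + r e₂) + x(t + r e₁ + r e₂)`. -/
def bilinDiff (r : ℕ) (x : ℕ × ℕ → ℝ) (t : ℕ × ℕ) : ℝ :=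
  x t - x (t.1 + r, t.2) - x (t.1, t.2 + r) + x (t.1 + r, t.2 + r)

/-- The quadratic variation at step `r` of data on `Λ_n`, an average over `Λ_{n-2r}`. -/
def quadVar (r n : ℕ) (x : ℕ × ℕ → ℝ) : ℝ :=
  (∑ t ∈ grid (n - 2 * r), bilinDiff r x t ^ 2) / ((grid (n - 2 * r)).card : ℝ)

/-- `a₁(φ) = |Γ(-φ)| (8 - 4 · 2^φ)`. -/
def aOne (φ : ℝ) : ℝ := |Real.Gamma (-φ)| * (8 - 4 * (2 : ℝ) ^ φ)

/-- The roughness estimator `φ̂₂ = ½ log₂ (Q₂ / Q₁)`. -/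
def phiTwoHat (n : ℕ) (x : ℕ × ℕ → ℝ) : ℝ :=
  1 / 2 * Real.logb 2 (quadVar 2 n x / quadVar 1 n x)

/-- The scale estimator `φ̂₁ = Q₁ / a₁(φ̂₂)`. -/
def phiOneHat (n : ℕ) (x : ℕ × ℕ → ℝ) : ℝ :=
  quadVar 1 n x / aOne (phiTwoHat n x)

/-! ### The asymptotic covariance -/

/-- The spectral density on `ℝ²` associated with the generalized covariance:
`f₀(λ) = 2^(2 φ₂ + 2) π Γ(1 + φ₂) φ₁ ‖λ‖^(-(2 + 2 φ₂))`, in the convention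
`K(h) = ∫ e^{i⟨h,λ⟩} f₀(λ) dλ / (2π)²` (as a generalized function). -/
def specDensity (φ₁ φ₂ : ℝ) (l : Plane) : ℝ :=
  (2 : ℝ) ^ (2 * φ₂ + 2) * Real.pi * Real.Gamma (1 + φ₂) * φ₁ * ‖l‖ ^ (-(2 + 2 * φ₂))

/-- The frequency `λ + 2π m`, for `m ∈ ℤ²`. -/
def shiftFreq (l : Plane) (m : ℤ × ℤ) : Plane :=
  !₂[l 0 + 2 * Real.pi * (m.1 : ℝ), l 1 + 2 * Real.pi * (m.2 : ℝ)]

/-- The aliased spectral density `f_X(λ) = ∑_{m ∈ ℤ²} f₀(λ + 2π m)`. -/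
def latticeSpec (φ₁ φ₂ : ℝ) (l : Plane) : ℝ :=
  ∑' m : ℤ × ℤ, specDensity φ₁ φ₂ (shiftFreq l m)

/-- The symbol `(1 - e^{i λ₁}) (1 - e^{i λ₂})` of the bilinear difference at step `1`. -/
def symbolOne (l : Plane) : ℂ :=
  (1 - Complex.exp (Complex.I * ((l 0 : ℝ) : ℂ))) *
    (1 - Complex.exp (Complex.I * ((l 1 : ℝ) : ℂ)))

/-- The spectral density of the differenced lattice field. -/
def diffSpec (φ₁ φ₂ : ℝ) (l : Plane) : ℝ :=
  ‖symbolOne l‖ ^ 2 * latticeSpec φ₁ φ₂ l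

/-- The bounded symbols `b₁ = 1` and `b₂ = 16 cos²(λ₁/2) cos²(λ₂/2)`. -/
def bSymbol (i : Fin 2) (l : Plane) : ℝ :=
  if i = 0 then 1 else 16 * Real.cos (l 0 / 2) ^ 2 * Real.cos (l 1 / 2) ^ 2

/-- The torus `(-π, π]²`. -/
def torus : Set Plane := {l | ∀ i, l i ∈ Set.Ioc (-Real.pi) Real.pi}

/-- The measure `(2π)⁻² dλ` on the torus. -/
def torusMeasure : Measure Plane :=
  ENNReal.ofReal (1 / (2 * Real.pi) ^ 2) • (volume : Measure Plane).restrict torus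

/-- The matrix `Σ` with entries `2 ∫ b_i b_j f² dμ`, where `f` is `diffSpec`. -/
def SigmaQ (φ₁ φ₂ : ℝ) : Matrix (Fin 2) (Fin 2) ℝ :=
  Matrix.of fun i j =>
    2 * ∫ l, bSymbol i l * bSymbol j l * diffSpec φ₁ φ₂ l ^ 2 ∂torusMeasure

/-- The moment map `h(y₁, y₂) = (y₁ / a₁(½ log₂ (y₂/y₁)), ½ log₂ (y₂/y₁))`. -/
def momentMap (y : Plane) : Plane :=
  !₂[y 0 / aOne (1 / 2 * Real.logb 2 (y 1 / y 0)), 1 / 2 * Real.logb 2 (y 1 / y 0)]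

/-- The Jacobian matrix of a map of the plane. -/
def jacobian (h : Plane → Plane) (q : Plane) : Matrix (Fin 2) (Fin 2) ℝ :=
  Matrix.of fun i j => (fderiv ℝ h q (EuclideanSpace.single j 1)) i

/-- The matrix `Σ_h = J Σ Jᵀ`, with `J` the Jacobian matrix of the moment map at `q`. -/
def SigmaH (φ₁ φ₂ : ℝ) (q : Plane) : Matrix (Fin 2) (Fin 2) ℝ :=
  jacobian momentMap q * SigmaQ φ₁ φ₂ * (jacobian momentMap q).transpose

/-- The matrix `K = diag(1/φ₁, 1)`. -/
def ratioMat (φ₁ : ℝ) : Matrix (Fin 2) (Fin 2) ℝ := Matrix.diagonal ![1 / φ₁, 1]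

end PowerLaw

end

namespace PowerLaw

/-! ### Characteristic functions of Gaussian quadratic forms -/

/-! The bilinear difference annihilates constants, so the increments of steps 1 and 2 form a jointly
stationary centred Gaussian field on the lattice. The power-law covariance is the transform of `f₀`
tested against `1 - cos` (`integral_one_sub_cos_mul_specDensity`). Folding the plane onto the torus
makes the increment covariances Fourier coefficients of an aliased cross-spectral density
(`crossCov_eq_integral`). That density is bounded (`exists_diffSpec_le`): near the origin the
squared symbol is `O(‖λ‖⁴)`, which beats the singularity `‖λ‖^(-(2 + 2 φ₂))` because `φ₂ < 1`.

Boundedness has two consequences. Covariance matrices of distinct increments have operator norm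
bounded uniformly in the grid (`exists_sum_crossCov_le`), and by Parseval the covariances are square
summable, with the integrals in `Σ` as sums of squares (`hasSum_crossCov_sq`).

A linear combination of the centred, `√N`-scaled quadratic variations is a quadratic form in a
Gaussian vector. Diagonalised, it is `∑ μᵢ (xᵢ² - 1)` with independent standard normal `xᵢ`. The
coefficients are `O(1/n)`, so `max |μᵢ| → 0`, and `∑ μᵢ²` converges to half the limit variance.
Comparing each factor of the characteristic function with `exp (-μᵢ²)` gives the limit
(`charFun_quadForm_approx`, `tendsto_charFun_quadVarVec`), and Lévy's continuity theorem gives the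
joint central limit theorem.

Finally the moment map sends `(q₁, q₂)` to `(φ₁, φ₂)`, since `q₁ = φ₁ a₁(φ₂)` and `q₂ = 2^(2 φ₂)
q₁`. The estimators are its values at `(Q₁, Q₂)`, and the delta method followed by the linear map
`K` finishes the proof. -/

lemma norm_prod_sub_prod_le {ι : Type*} (s : Finset ι) (f g : ι → ℂ)
    (hf : ∀ i ∈ s, ‖f i‖ ≤ 1) (hg : ∀ i ∈ s, ‖g i‖ ≤ 1) :
    ‖∏ i ∈ s, f i - ∏ i ∈ s, g i‖ ≤ ∑ i ∈ s, ‖f i - g i‖ := by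
  classical
  induction s using Finset.induction_on with
  | empty => simp
  | insert j s hj ih =>
    rw [Finset.prod_insert hj, Finset.prod_insert hj, Finset.sum_insert hj]
    have h1 : f j * ∏ i ∈ s, f i - g j * ∏ i ∈ s, g i =
        (f j - g j) * ∏ i ∈ s, f i + g j * (∏ i ∈ s, f i - ∏ i ∈ s, g i) := by ring
    have h2 : ‖∏ i ∈ s, f i‖ ≤ 1 := by
      rw [norm_prod]
      exact Finset.prod_le_one (fun _ _ => norm_nonneg _)
        fun i hi => hf i (Finset.mem_insert_of_mem hi)
    rw [h1]
    refine (norm_add_le _ _).trans (add_le_add ?_ ?_)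
    · rw [norm_mul]
      exact mul_le_of_le_one_right (norm_nonneg _) h2
    · rw [norm_mul]
      refine (mul_le_of_le_one_left (norm_nonneg _) (hg j (Finset.mem_insert_self _ _))).trans ?_
      exact ih (fun i hi => hf i (Finset.mem_insert_of_mem hi))
        fun i hi => hg i (Finset.mem_insert_of_mem hi)

lemma integral_pow_four_gaussianReal : ∫ x, x ^ 4 ∂(gaussianReal 0 1) = 3 := by
  rw [integral_gaussianReal_eq_integral_smul one_ne_zero]
  have h1 : ∀ x : ℝ, gaussianPDFReal 0 1 x • x ^ 4 =
      (√(2 * Real.pi))⁻¹ * (fun y : ℝ => y ^ (4 : ℝ) * Real.exp (-(1 / 2) * y ^ (2 : ℝ))) |x| := by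
    intro x
    have h4 : |x| ^ (4 : ℝ) = x ^ 4 := by
      rw [show (4 : ℝ) = ((4 : ℕ) : ℝ) by norm_num, Real.rpow_natCast]
      exact Even.pow_abs ⟨2, rfl⟩ x
    have h5 : |x| ^ (2 : ℝ) = x ^ 2 := by
      rw [show (2 : ℝ) = ((2 : ℕ) : ℝ) by norm_num, Real.rpow_natCast]
      exact Even.pow_abs ⟨1, rfl⟩ x
    simp only [h4, h5, gaussianPDFReal, NNReal.coe_one, sub_zero, mul_one, smul_eq_mul]
    rw [show -x ^ 2 / 2 = -(1 / 2) * x ^ 2 by ring]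
    ring
  simp_rw [h1]
  rw [integral_const_mul, integral_comp_abs
    (f := fun y : ℝ => y ^ (4 : ℝ) * Real.exp (-(1 / 2) * y ^ (2 : ℝ))), integral_rpow_mul_exp_neg_mul_rpow (by norm_num)
    (by norm_num) (by norm_num)]
  have h2 : Real.Gamma ((4 + 1) / 2) = 3 / 4 * √Real.pi := by
    rw [show ((4 : ℝ) + 1) / 2 = (1 / 2 + 1) + 1 by norm_num, Real.Gamma_add_one (by norm_num),
      Real.Gamma_add_one (by norm_num), Real.Gamma_one_half_eq]
    ring
  have h3 : (1 / 2 : ℝ) ^ (-((4 : ℝ) + 1) / 2) = 4 * √2 := by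
    rw [one_div, Real.inv_rpow (by norm_num), ← Real.rpow_neg (by norm_num), Real.sqrt_eq_rpow,
      show -(-((4 : ℝ) + 1) / 2) = 2 + 1 / 2 by norm_num, Real.rpow_add (by norm_num)]
    norm_num
  rw [h2, h3, Real.sqrt_mul (by norm_num)]
  have : √2 ≠ 0 := by positivity
  have : √Real.pi ≠ 0 := by positivity
  field_simp

lemma integrable_pow_gaussianReal (k : ℕ) : Integrable (fun x : ℝ => x ^ k) (gaussianReal 0 1) := by
  have := (memLp_id_gaussianReal (μ := 0) (v := 1) (k : NNReal))
  rcases Nat.eq_zero_or_pos k with rfl | hk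
  · simp
  have h := this.integrable_norm_rpow (by simpa using hk.ne') (by simp)
  rw [← integrable_norm_iff (by fun_prop)]
  simpa [abs_pow] using h

lemma integral_sq_gaussianReal : ∫ x, x ^ 2 ∂(gaussianReal 0 1) = 1 := by
  have h := variance_fun_id_gaussianReal (μ := 0) (v := 1)
  rw [variance_of_integral_eq_zero (by fun_prop) (by simp)] at h
  simpa using h

/-- With `Z = (x² - 1)/√2`, of mean 0 and variance 1 because `E x⁴ = 3`, the integral is the
characteristic function of `Z` at `√2 s`. Its second-order Taylor polynomial `1 - s²` is also the
first-order expansion of `exp (-s²)` in `s²`. -/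
lemma charFun_sq_sub_one_approx {ε : ℝ} (hε : 0 < ε) :
    ∃ δ > 0, ∀ s : ℝ, |s| ≤ δ →
      ‖∫ x : ℝ, Complex.exp (Complex.I * ((s * (x ^ 2 - 1) : ℝ) : ℂ)) ∂(gaussianReal 0 1) -
        Complex.exp (-(s : ℂ) ^ 2)‖ ≤ ε * s ^ 2 := by
  set Z : ℝ → ℝ := fun x => (x ^ 2 - 1) / √2 with hZ
  have hm : AEMeasurable Z (gaussianReal 0 1) := by fun_prop
  have h2 : √(2 : ℝ) ≠ 0 := by positivity
  have i2 := integrable_pow_gaussianReal 2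
  have i4 := integrable_pow_gaussianReal 4
  have h0 : ∫ x, Z x ∂(gaussianReal 0 1) = 0 := by
    simp only [hZ]
    rw [integral_div, integral_sub i2 (integrable_const _), integral_sq_gaussianReal]
    simp
  have h1 : ∫ x, (Z ^ 2) x ∂(gaussianReal 0 1) = 1 := by
    have : ∀ x, (Z ^ 2) x = (x ^ 4 - 2 * x ^ 2 + 1) / 2 := by
      intro x
      simp only [hZ, Pi.pow_apply, div_pow, Real.sq_sqrt (show (0 : ℝ) ≤ 2 by norm_num)]
      ring
    simp_rw [this]
    have i5 : Integrable (fun x : ℝ => x ^ 4 - 2 * x ^ 2) (gaussianReal 0 1) :=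
      i4.sub (i2.const_mul _)
    rw [integral_div, integral_add i5 (integrable_const _),
      integral_sub i4 (i2.const_mul _), integral_const_mul, integral_pow_four_gaussianReal,
      integral_sq_gaussianReal]
    norm_num
  have ht := taylor_charFun_two hm h0 h1
  have ht' := (ht.def (show 0 < ε / 4 by positivity))
  rw [Metric.eventually_nhds_iff] at ht'
  obtain ⟨η, hη, H⟩ := ht'
  -- The bound `η / 4` keeps `√2 s` in the Taylor neighbourhood, `1` permits the quadratic bound on
  -- `exp`, and `√(ε / 2)` gives `s⁴ ≤ (ε / 2) s²`. The Taylor error is `(ε / 4) · 2 s²`, so the two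
  -- errors add up to `ε s²`.
  refine ⟨min (η / 4) (min 1 (√(ε / 2))), by positivity, fun s hs => ?_⟩
  have hs1 : |s| ≤ η / 4 := hs.trans (min_le_left _ _)
  have hs2 : |s| ≤ 1 := hs.trans ((min_le_right _ _).trans (min_le_left _ _))
  have hs3 : |s| ≤ √(ε / 2) := hs.trans ((min_le_right _ _).trans (min_le_right _ _))
  have hs4 : s ^ 2 ≤ ε / 2 := by
    rw [← sq_abs]
    calc |s| ^ 2 ≤ √(ε / 2) ^ 2 := by gcongr
      _ = ε / 2 := Real.sq_sqrt (by positivity)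
  have hr2 : √(2 : ℝ) < 2 := by
    rw [Real.sqrt_lt' (by norm_num)]; norm_num
  have hc : ∫ x : ℝ, Complex.exp (Complex.I * ((s * (x ^ 2 - 1) : ℝ) : ℂ)) ∂(gaussianReal 0 1) =
      charFun ((gaussianReal 0 1).map Z) (√2 * s) := by
    rw [charFun_apply_real, integral_map hm (by fun_prop)]
    refine integral_congr_ae (ae_of_all _ fun x => ?_)
    have h5 : (((√2 * s : ℝ) : ℂ) * ((Z x : ℝ) : ℂ)) = ((s * (x ^ 2 - 1) : ℝ) : ℂ) := by
      rw [← Complex.ofReal_mul]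
      congr 1
      simp only [hZ]
      field_simp
    simp only [h5, mul_comm Complex.I]
  have hd : dist (√2 * s) 0 < η := by
    rw [dist_zero_right, Real.norm_eq_abs, abs_mul, abs_of_pos (by positivity : (0 : ℝ) < √2)]
    nlinarith [abs_nonneg s]
  have hA := H hd
  have h6 : (((√2 * s : ℝ) : ℂ)) ^ 2 = 2 * (s : ℂ) ^ 2 := by
    rw [← Complex.ofReal_pow, mul_pow, Real.sq_sqrt (by norm_num)]
    push_cast; ring
  rw [h6] at hA
  have h7 : ‖((√2 * s) ^ 2 : ℝ)‖ = 2 * s ^ 2 := by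
    rw [mul_pow, Real.sq_sqrt (by norm_num), Real.norm_of_nonneg (by positivity)]
  rw [h7] at hA
  have hns : ‖-(s : ℂ) ^ 2‖ = s ^ 2 := by
    rw [norm_neg, norm_pow, Complex.norm_real, Real.norm_eq_abs, sq_abs]
  have hB := Complex.norm_exp_sub_one_sub_id_le (x := -(s : ℂ) ^ 2) (by
    rw [hns, ← sq_abs]; exact pow_le_one₀ (abs_nonneg _) hs2)
  rw [hns] at hB
  rw [hc]
  have h8 : charFun ((gaussianReal 0 1).map Z) (√2 * s) - Complex.exp (-(s : ℂ) ^ 2) =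
      (charFun ((gaussianReal 0 1).map Z) (√2 * s) - (1 - 2 * (s : ℂ) ^ 2 / 2)) -
      (Complex.exp (-(s : ℂ) ^ 2) - 1 - -(s : ℂ) ^ 2) := by ring
  rw [h8]
  refine (norm_sub_le _ _).trans ?_
  nlinarith [sq_nonneg s]

open scoped MatrixOrder in
/-- The characteristic function at `1` of a centred quadratic form `∑ aᵢ (Yᵢ² - Γᵢᵢ)` in a Gaussian
vector with covariance `Γ` is close to that of a normal law with the same variance, provided that
the coefficients are small compared with the norm of `Γ`. -/
lemma charFun_quadForm_approx {ε : ℝ} (hε : 0 < ε) :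
    ∃ δ > 0, ∀ (ι : Type) [Fintype ι] [DecidableEq ι] (Γ : Matrix ι ι ℝ) (_ : Γ.PosSemidef)
      (a : ι → ℝ) (α κ : ℝ) (_ : ∀ i, |a i| ≤ α) (_ : ∀ c : ι → ℝ, c ⬝ᵥ Γ.mulVec c ≤ κ * (c ⬝ᵥ c))
      (_ : α * κ ≤ δ),
      ‖∫ y : EuclideanSpace ℝ ι, Complex.exp (Complex.I * ((∑ i, a i * (y i ^ 2 - Γ i i) : ℝ) : ℂ))
          ∂(multivariateGaussian 0 Γ) -
        Complex.exp (-((∑ i, ∑ j, a i * a j * Γ i j ^ 2 : ℝ) : ℂ))‖ ≤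
      ε * ∑ i, ∑ j, a i * a j * Γ i j ^ 2 := by
  obtain ⟨δ, hδ, H⟩ := charFun_sq_sub_one_approx hε
  refine ⟨δ, hδ, fun ι _ _ Γ hΓ a α κ hα hκ hακ => ?_⟩
  set R : Matrix ι ι ℝ := CFC.sqrt Γ with hR
  have hRR : R * R = Γ := CFC.sqrt_mul_sqrt_self _ hΓ.nonneg
  have hRt : R.transpose = R := by
    have h := (CFC.sqrt_nonneg Γ).isSelfAdjoint
    have h2 : star R = R := h
    rwa [Matrix.star_eq_conjTranspose, Matrix.conjTranspose_eq_transpose_of_trivial] at h2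
  have hΓt : Γ.transpose = Γ := by rw [← hRR, Matrix.transpose_mul, hRt]
  -- For `y = R z` with `z` standard normal, `∑ aᵢ yᵢ² = zᵀ B z`. An orthonormal eigenbasis of `B`
  -- turns this into a weighted sum of independent squares.
  set B : Matrix ι ι ℝ := R * Matrix.diagonal a * R with hB
  have hBh : B.IsHermitian := by
    rw [Matrix.IsHermitian, Matrix.conjTranspose_eq_transpose_of_trivial, hB,
      Matrix.transpose_mul, Matrix.transpose_mul, hRt, Matrix.diagonal_transpose, Matrix.mul_assoc]
  set b := hBh.eigenvectorBasis with hb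
  set μ := hBh.eigenvalues with hμ
  have hquad : ∀ z w : ι → ℝ, z ⬝ᵥ B.mulVec w = ∑ j, a j * (R.mulVec z j * R.mulVec w j) := by
    intro z w
    rw [hB, ← Matrix.mulVec_mulVec, ← Matrix.mulVec_mulVec, Matrix.dotProduct_mulVec,
      ← Matrix.mulVec_transpose, hRt, dotProduct]
    refine Finset.sum_congr rfl fun j _ => ?_
    rw [Matrix.mulVec_diagonal]; ring
  have hnorm : ∀ z : ι → ℝ, R.mulVec z ⬝ᵥ R.mulVec z = z ⬝ᵥ Γ.mulVec z := by
    intro z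
    rw [← hRR, ← Matrix.mulVec_mulVec, Matrix.dotProduct_mulVec z R, ← Matrix.mulVec_transpose, hRt]
  -- eigenvalues
  have hbb : ∀ i j, (b i).ofLp ⬝ᵥ (b j).ofLp = if i = j then 1 else 0 := by
    intro i j
    have := orthonormal_iff_ite.1 b.orthonormal j i
    rw [EuclideanSpace.inner_eq_star_dotProduct] at this
    simp only [star_trivial] at this
    rw [this]; simp [eq_comm]
  -- For a unit eigenvector `b`, `|bᵀ B b| ≤ α ‖R b‖² = α bᵀ Γ b ≤ α κ`.
  have hμ_le : ∀ i, |μ i| ≤ δ := by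
    intro i
    have h1 : μ i = ∑ j, a j * (R.mulVec (b i).ofLp j * R.mulVec (b i).ofLp j) := by
      rw [← hquad, hBh.mulVec_eigenvectorBasis, dotProduct_smul, hbb]; simp [hμ]
    have hα0 : 0 ≤ α := (abs_nonneg _).trans (hα i)
    rw [h1]
    calc |∑ j, a j * (R.mulVec (b i).ofLp j * R.mulVec (b i).ofLp j)|
        ≤ ∑ j, |a j * (R.mulVec (b i).ofLp j * R.mulVec (b i).ofLp j)| :=
          Finset.abs_sum_le_sum_abs _ _
      _ ≤ ∑ j, α * (R.mulVec (b i).ofLp j * R.mulVec (b i).ofLp j) := by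
          refine Finset.sum_le_sum fun j _ => ?_
          rw [abs_mul, abs_mul_self]
          exact mul_le_mul_of_nonneg_right (hα j) (mul_self_nonneg _)
      _ = α * ((b i).ofLp ⬝ᵥ Γ.mulVec (b i).ofLp) := by
          rw [← Finset.mul_sum, ← hnorm]; rfl
      _ ≤ α * (κ * 1) := by
          refine mul_le_mul_of_nonneg_left ((hκ _).trans_eq ?_) hα0
          rw [hbb]; simp
      _ ≤ δ := by simpa using hακ
  have htr : ∑ i, μ i = ∑ i, a i * Γ i i := by
    have h1 := hBh.trace_eq_sum_eigenvalues
    have h2 : B.trace = (Γ * Matrix.diagonal a).trace := by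
      rw [hB, Matrix.trace_mul_comm, ← Matrix.mul_assoc, hRR]
    simp only [RCLike.ofReal_real_eq_id, id_eq] at h1
    rw [hμ, ← h1, h2, Matrix.trace]
    exact Finset.sum_congr rfl fun i _ => by rw [Matrix.diag_apply, Matrix.mul_diagonal, mul_comm]
  -- Both sides are `tr B²`; cyclicity of the trace replaces `B` by `Γ * diagonal a`.
  have htr2 : ∑ i, μ i ^ 2 = ∑ i, ∑ j, a i * a j * Γ i j ^ 2 := by
    have h1 : (B * B).trace = ∑ i, μ i ^ 2 := by
      have h2 := hBh.spectral_theorem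
      have h3 : (B * B) = Unitary.conjStarAlgAut ℝ (Matrix ι ι ℝ) hBh.eigenvectorUnitary
          (Matrix.diagonal (RCLike.ofReal ∘ hBh.eigenvalues) *
            Matrix.diagonal (RCLike.ofReal ∘ hBh.eigenvalues)) := by
        rw [map_mul, ← h2]
      rw [h3, Unitary.conjStarAlgAut_apply, Matrix.trace_mul_comm, ← Matrix.mul_assoc]
      simp [Matrix.diagonal_mul_diagonal, Matrix.trace_diagonal, hμ, sq]
    have h4 : (B * B).trace = (Γ * Matrix.diagonal a * (Γ * Matrix.diagonal a)).trace := by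
      have h5 : B * B = R * (Matrix.diagonal a * Γ * Matrix.diagonal a * R) := by
        rw [hB, ← hRR]; simp only [Matrix.mul_assoc]
      rw [h5, Matrix.trace_mul_comm, Matrix.mul_assoc, hRR, Matrix.trace_mul_comm]
      simp only [Matrix.mul_assoc]
    rw [← h1, h4, Matrix.trace]
    refine Finset.sum_congr rfl fun i _ => ?_
    rw [Matrix.diag_apply, Matrix.mul_apply]
    refine Finset.sum_congr rfl fun j _ => ?_
    rw [Matrix.mul_diagonal, Matrix.mul_diagonal]
    have : Γ j i = Γ i j := congrFun (congrFun hΓt i) j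
    rw [this]; ring
  -- the integral
  have hint : ∫ y : EuclideanSpace ℝ ι,
      Complex.exp (Complex.I * ((∑ i, a i * (y i ^ 2 - Γ i i) : ℝ) : ℂ))
          ∂(multivariateGaussian 0 Γ) =
      ∏ i, ∫ x : ℝ, Complex.exp (Complex.I * ((μ i * (x ^ 2 - 1) : ℝ) : ℂ))
        ∂(gaussianReal 0 1) := by
    rw [multivariateGaussian, integral_map (by fun_prop) (by fun_prop),
      stdGaussian_eq_map_pi_orthonormalBasis b,
      integral_map (Measurable.aemeasurable (by fun_prop)) (by fun_prop),
      ← integral_fintype_prod_eq_prod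
        (f := fun i (x : ℝ) => Complex.exp (Complex.I * ((μ i * (x ^ 2 - 1) : ℝ) : ℂ)))]
    refine integral_congr_ae (ae_of_all _ fun x => ?_)
    simp only
    rw [← Complex.exp_sum, ← Finset.mul_sum, ← Complex.ofReal_sum]
    congr 3
    simp only [zero_add, Matrix.ofLp_toEuclideanCLM]
    have hz : (∑ i, x i • b i : EuclideanSpace ℝ ι).ofLp = ∑ i, x i • (b i).ofLp := by
      simp
    have h1 := hquad (∑ i, x i • b i : EuclideanSpace ℝ ι).ofLp
      (∑ i, x i • b i : EuclideanSpace ℝ ι).ofLp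
    have h2 : (∑ i, x i • b i : EuclideanSpace ℝ ι).ofLp ⬝ᵥ
        B.mulVec (∑ i, x i • b i : EuclideanSpace ℝ ι).ofLp = ∑ i, μ i * x i ^ 2 := by
      rw [hz, Matrix.mulVec_sum, sum_dotProduct]
      refine Finset.sum_congr rfl fun i _ => ?_
      rw [dotProduct_sum, Finset.sum_eq_single i]
      · rw [Matrix.mulVec_smul, hBh.mulVec_eigenvectorBasis, smul_dotProduct, dotProduct_smul,
          dotProduct_smul, hbb]
        simp [hμ]; ring
      · intro j _ hj
        rw [Matrix.mulVec_smul, hBh.mulVec_eigenvectorBasis, smul_dotProduct, dotProduct_smul,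
          dotProduct_smul, hbb, if_neg (Ne.symm hj)]
        simp
      · simp
    simp only [mul_sub, Finset.sum_sub_distrib, mul_one, htr]
    congr 1
    rw [← h2, h1]
    exact Finset.sum_congr rfl fun j _ => by rw [sq]
  rw [hint, ← htr2]
  have hexp : Complex.exp (-((∑ i, μ i ^ 2 : ℝ) : ℂ)) = ∏ i, Complex.exp (-(μ i : ℂ) ^ 2) := by
    rw [← Complex.exp_sum]
    congr 1
    push_cast
    rw [Finset.sum_neg_distrib]
  rw [hexp, Finset.mul_sum]
  -- All factors lie in the unit disc, so the difference of the products is at most the sum of the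
  -- one-dimensional errors `ε μᵢ²`.
  refine (norm_prod_sub_prod_le _ _ _ ?_ ?_).trans (Finset.sum_le_sum fun i _ => H _ (hμ_le i))
  · intro i _
    refine (norm_integral_le_of_norm_le_const (C := 1) (ae_of_all _ fun x => ?_)).trans_eq (by simp)
    rw [mul_comm, Complex.norm_exp_ofReal_mul_I]
  · intro i _
    rw [Complex.norm_exp]
    have : (-(μ i : ℂ) ^ 2).re = -(μ i ^ 2) := by
      rw [← Complex.ofReal_pow, ← Complex.ofReal_neg, Complex.ofReal_re]
    rw [this]
    exact Real.exp_le_one_iff.2 (by nlinarith [sq_nonneg (μ i)])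

/-! ### The spectral representation of the power-law generalized covariance -/

lemma lintegral_rpow_mul_exp_neg {a r : ℝ} (ha : 0 < a) (hr : 0 < r) :
    ∫⁻ t in Set.Ioi (0 : ℝ), ENNReal.ofReal (t ^ (a - 1) * Real.exp (-(r * t))) =
      ENNReal.ofReal (r ^ (-a) * Real.Gamma a) := by
  rw [← ofReal_integral_eq_lintegral_ofReal, Real.integral_rpow_mul_exp_neg_mul_Ioi ha hr, one_div,
    Real.inv_rpow hr.le, Real.rpow_neg hr.le]
  · have := integrableOn_rpow_mul_exp_neg_mul_rpow (p := 1) (s := a - 1) (b := r) (by linarith)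
      one_pos hr
    simpa [IntegrableOn] using this
  · refine (ae_restrict_mem measurableSet_Ioi).mono fun t ht => ?_
    have : (0 : ℝ) < t := ht
    simp only [Pi.zero_apply]
    positivity

/-- Write `1 - exp (-(k y))` as `y` times the integral of `exp (-(u y))` over `u ∈ (0, k]` and apply
Tonelli. The inner integral is a Gamma integral, convergent at 0 since `H < 1`; what remains is
`u^(H - 1)`, integrable at 0 since `H > 0`. -/
lemma lintegral_rpow_mul_one_sub_exp_neg {H k : ℝ} (hH : 0 < H) (hH1 : H < 1) (hk : 0 ≤ k) :
    ∫⁻ y in Set.Ioi (0 : ℝ), ENNReal.ofReal (y ^ (-H - 1) * (1 - Real.exp (-(k * y)))) =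
      ENNReal.ofReal (Real.Gamma (1 - H) * (k ^ H / H)) := by
  have h1 : ∀ y ∈ Set.Ioi (0 : ℝ), ENNReal.ofReal (y ^ (-H - 1) * (1 - Real.exp (-(k * y)))) =
      ∫⁻ u in Set.Ioc 0 k, ENNReal.ofReal (y ^ ((1 - H) - 1) * Real.exp (-(u * y))) := by
    intro y hy
    have hy : (0 : ℝ) < y := hy
    have hd : ∀ u ∈ Set.uIcc 0 k, HasDerivAt (fun u => -(y ^ (-H - 1) * Real.exp (-(u * y))))
        (y ^ ((1 - H) - 1) * Real.exp (-(u * y))) u := by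
      intro u _
      have h2 : HasDerivAt (fun u => Real.exp (-(u * y))) (Real.exp (-(u * y)) * -(1 * y)) u :=
        (((hasDerivAt_id u).mul_const y).neg).exp
      have h3 := (h2.const_mul (y ^ (-H - 1))).neg
      refine h3.congr_deriv ?_
      rw [show (1 - H) - 1 = (-H - 1) + 1 by ring, Real.rpow_add_one hy.ne']
      ring
    have hc : Continuous fun u => y ^ ((1 - H) - 1) * Real.exp (-(u * y)) := by fun_prop
    have h4 := intervalIntegral.integral_eq_sub_of_hasDerivAt hd (hc.intervalIntegrable _ _)
    rw [← ofReal_integral_eq_lintegral_ofReal (hc.integrableOn_Ioc)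
      (ae_of_all _ fun u => by simp only [Pi.zero_apply]; positivity),
      ← intervalIntegral.integral_of_le hk, h4]
    congr 1
    simp
    ring
  rw [setLIntegral_congr_fun measurableSet_Ioi h1, lintegral_lintegral_swap (by
    refine Measurable.aemeasurable (Measurable.ennreal_ofReal ?_)
    fun_prop)]
  have h5 : ∀ u ∈ Set.Ioc 0 k, ∫⁻ y in Set.Ioi (0 : ℝ),
      ENNReal.ofReal (y ^ ((1 - H) - 1) * Real.exp (-(u * y))) =
      ENNReal.ofReal (u ^ (H - 1) * Real.Gamma (1 - H)) := by
    intro u hu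
    rw [lintegral_rpow_mul_exp_neg (by linarith) hu.1, neg_sub]
  have hi : IntegrableOn (fun u : ℝ => u ^ (H - 1) * Real.Gamma (1 - H)) (Set.Ioc 0 k) :=
    ((intervalIntegrable_iff_integrableOn_Ioc_of_le hk).1
      (intervalIntegral.intervalIntegrable_rpow' (by linarith))).mul_const _
  have hΓ : 0 < Real.Gamma (1 - H) := Real.Gamma_pos_of_pos (by linarith)
  rw [setLIntegral_congr_fun measurableSet_Ioc h5, ← ofReal_integral_eq_lintegral_ofReal hi,
    ← intervalIntegral.integral_of_le hk, intervalIntegral.integral_mul_const,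
    integral_rpow (Or.inl (by linarith))]
  · congr 1
    rw [sub_add_cancel, Real.zero_rpow hH.ne', sub_zero]; ring
  · refine (ae_restrict_mem measurableSet_Ioc).mono fun u hu => ?_
    have : (0 : ℝ) < u := hu.1
    simp only [Pi.zero_apply]
    positivity

/-- The substitution `y = 1 / t` reduces this to the preceding integral. -/
lemma lintegral_rpow_mul_one_sub_exp_neg_div {H k : ℝ} (hH : 0 < H) (hH1 : H < 1) (hk : 0 ≤ k) :
    ∫⁻ t in Set.Ioi (0 : ℝ), ENNReal.ofReal (t ^ (H - 1) * (1 - Real.exp (-(k / t)))) =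
      ENNReal.ofReal (Real.Gamma (1 - H) * (k ^ H / H)) := by
  set g : ℝ → ℝ := fun y => y ^ (-H - 1) * (1 - Real.exp (-(k * y))) with hg
  have hnn : ∀ y ∈ Set.Ioi (0 : ℝ), 0 ≤ g y := by
    intro y hy
    have hy : (0 : ℝ) < y := hy
    have : Real.exp (-(k * y)) ≤ 1 := Real.exp_le_one_iff.2 (by nlinarith)
    exact mul_nonneg (by positivity) (by linarith)
  have hgi : IntegrableOn g (Set.Ioi 0) := by
    refine ⟨Measurable.aestronglyMeasurable (by fun_prop), ?_⟩
    rw [hasFiniteIntegral_iff_ofReal ((ae_restrict_mem measurableSet_Ioi).mono hnn),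
      lintegral_rpow_mul_one_sub_exp_neg hH hH1 hk]
    exact ENNReal.ofReal_lt_top
  have hf : ∀ t ∈ Set.Ioi (0 : ℝ), t ^ (H - 1) * (1 - Real.exp (-(k / t))) =
      (|(-1 : ℝ)| * t ^ ((-1 : ℝ) - 1)) • g (t ^ (-1 : ℝ)) := by
    intro t ht
    have ht : (0 : ℝ) < t := ht
    simp only [hg, smul_eq_mul, abs_neg, abs_one, one_mul]
    rw [← Real.rpow_mul ht.le, ← mul_assoc, ← Real.rpow_add ht, Real.rpow_neg_one, div_eq_mul_inv]
    congr 2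
    ring
  have hfi := (integrableOn_Ioi_comp_rpow_iff g (p := -1) (by norm_num)).2 hgi
  have h1 := integral_comp_rpow_Ioi g (p := -1) (by norm_num)
  rw [setLIntegral_congr_fun measurableSet_Ioi fun t ht => congrArg ENNReal.ofReal (hf t ht),
    ← ofReal_integral_eq_lintegral_ofReal hfi, h1,
    ofReal_integral_eq_lintegral_ofReal hgi ((ae_restrict_mem measurableSet_Ioi).mono hnn),
    lintegral_rpow_mul_one_sub_exp_neg hH hH1 hk]
  refine (ae_restrict_mem measurableSet_Ioi).mono fun t ht => ?_
  have ht : (0 : ℝ) < t := ht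
  exact mul_nonneg (by positivity) (hnn _ (Real.rpow_pos_of_pos ht _))

lemma lintegral_one_sub_cos_mul_exp (h : Plane) {t : ℝ} (ht : 0 < t) :
    ∫⁻ l : Plane, ENNReal.ofReal ((1 - Real.cos (inner ℝ h l)) * Real.exp (-(t * ‖l‖ ^ 2))) =
      ENNReal.ofReal (Real.pi / t * (1 - Real.exp (-(‖h‖ ^ 2 / 4 / t)))) := by
  have hre : 0 < (t : ℂ).re := by simpa using ht
  have key : ∀ w : Plane, Integrable (fun l : Plane => Real.cos (inner ℝ w l) *
        Real.exp (-(t * ‖l‖ ^ 2))) ∧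
      ∫ l : Plane, Real.cos (inner ℝ w l) * Real.exp (-(t * ‖l‖ ^ 2)) =
        Real.pi / t * Real.exp (-(‖w‖ ^ 2 / 4 / t)) := by
    intro w
    have hi := GaussianFourier.integrable_cexp_neg_mul_sq_norm_add_of_euclideanSpace
      (ι := Fin 2) hre Complex.I w
    have he := GaussianFourier.integral_cexp_neg_mul_sq_norm_add_of_euclideanSpace
      (ι := Fin 2) hre Complex.I w
    have hr : ∀ l : Plane, (Complex.exp (-(t : ℂ) * (‖l‖ : ℂ) ^ 2 +
        Complex.I * ((inner ℝ w l : ℝ) : ℂ))).re =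
        Real.cos (inner ℝ w l) * Real.exp (-(t * ‖l‖ ^ 2)) := by
      intro l
      rw [Complex.exp_re]
      have h1 : (-(t : ℂ) * (‖l‖ : ℂ) ^ 2 + Complex.I * ((inner ℝ w l : ℝ) : ℂ)) =
          ((-(t * ‖l‖ ^ 2) : ℝ) : ℂ) + ((inner ℝ w l : ℝ) : ℂ) * Complex.I := by
        push_cast; ring
      rw [h1]
      simp only [Complex.add_re, Complex.add_im, Complex.ofReal_re, Complex.ofReal_im,
        Complex.re_ofReal_mul, Complex.im_ofReal_mul, Complex.I_re, Complex.I_im, mul_zero, mul_one,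
        add_zero, zero_add]
      ring
    have hre1 := hi.re
    simp only [RCLike.re_eq_complex_re, hr] at hre1
    refine ⟨hre1, ?_⟩
    have h2 := integral_re hi
    simp only [RCLike.re_eq_complex_re, hr] at h2
    rw [h2, he]
    have h3 : ((Real.pi : ℂ) / t) ^ (((Fintype.card (Fin 2) : ℕ) : ℂ) / 2) *
        Complex.exp (Complex.I ^ 2 * (‖w‖ : ℂ) ^ 2 / (4 * t)) =
        ((Real.pi / t * Real.exp (-(‖w‖ ^ 2 / 4 / t)) : ℝ) : ℂ) := by
      have : (((Fintype.card (Fin 2) : ℕ) : ℂ) / 2) = 1 := by simp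
      rw [this, Complex.cpow_one, Complex.I_sq]
      push_cast
      congr 2
      have : (t : ℂ) ≠ 0 := by exact_mod_cast ht.ne'
      field_simp
    rw [h3, Complex.ofReal_re]
  obtain ⟨i1, e1⟩ := key h
  obtain ⟨i0, e0⟩ := key 0
  simp only [inner_zero_left, Real.cos_zero, one_mul, norm_zero] at i0 e0
  have h4 : ∀ l : Plane, (1 - Real.cos (inner ℝ h l)) * Real.exp (-(t * ‖l‖ ^ 2)) =
      Real.exp (-(t * ‖l‖ ^ 2)) - Real.cos (inner ℝ h l) * Real.exp (-(t * ‖l‖ ^ 2)) := by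
    intro l; ring
  rw [← ofReal_integral_eq_lintegral_ofReal]
  · simp_rw [h4]
    rw [integral_sub i0 i1, e0, e1]
    congr 1
    simp
    ring
  · simp_rw [h4]; exact i0.sub i1
  · refine ae_of_all _ fun l => ?_
    exact mul_nonneg (by linarith [Real.cos_le_one (inner ℝ h l)]) (Real.exp_pos _).le

/-- Subordination: `‖l‖^(-(2 + 2H))` is the mixture `Γ(1 + H)⁻¹ ∫ t^H exp (-t ‖l‖²) dt` of
Gaussians. After Tonelli, the Gaussian Fourier transform handles `l` and a one-dimensional integral
remains. Working with `∫⁻` makes finiteness a conclusion. -/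
lemma lintegral_one_sub_cos_mul_norm_rpow {H : ℝ} (hH : 0 < H) (hH1 : H < 1) (h : Plane) :
    ∫⁻ l : Plane, ENNReal.ofReal ((1 - Real.cos (inner ℝ h l)) * ‖l‖ ^ (-(2 + 2 * H))) =
      ENNReal.ofReal (Real.pi * (Real.Gamma (1 - H) * ((‖h‖ ^ 2 / 4) ^ H / H)) /
        Real.Gamma (1 + H)) := by
  have hG : 0 < Real.Gamma (1 + H) := Real.Gamma_pos_of_pos (by linarith)
  have hnn : ∀ l : Plane, 0 ≤ 1 - Real.cos (inner ℝ h l) :=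
    fun l => by linarith [Real.cos_le_one (inner ℝ h l)]
  have h1 : ∀ l : Plane, ENNReal.ofReal ((1 - Real.cos (inner ℝ h l)) * ‖l‖ ^ (-(2 + 2 * H))) =
      ENNReal.ofReal (Real.Gamma (1 + H))⁻¹ * ∫⁻ t in Set.Ioi (0 : ℝ),
        ENNReal.ofReal (t ^ H * ((1 - Real.cos (inner ℝ h l)) * Real.exp (-(t * ‖l‖ ^ 2)))) := by
    intro l
    -- At the origin both sides vanish through the factor `1 - cos`.
    rcases eq_or_ne l 0 with rfl | hl
    · simp
    have hl : 0 < ‖l‖ := norm_pos_iff.2 hl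
    have h2 : ∀ t ∈ Set.Ioi (0 : ℝ),
        ENNReal.ofReal (t ^ H * ((1 - Real.cos (inner ℝ h l)) * Real.exp (-(t * ‖l‖ ^ 2)))) =
        ENNReal.ofReal (1 - Real.cos (inner ℝ h l)) *
          ENNReal.ofReal (t ^ ((1 + H) - 1) * Real.exp (-(‖l‖ ^ 2 * t))) := by
      intro t _
      rw [← ENNReal.ofReal_mul (hnn l)]
      congr 1
      rw [add_sub_cancel_left, mul_comm t]; ring
    rw [setLIntegral_congr_fun measurableSet_Ioi h2, lintegral_const_mul _ (by fun_prop),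
      lintegral_rpow_mul_exp_neg (by linarith) (by positivity), ← ENNReal.ofReal_mul (hnn l),
      ← ENNReal.ofReal_mul (by positivity)]
    congr 1
    rw [← Real.rpow_natCast, ← Real.rpow_mul hl.le]
    have : ((2 : ℕ) : ℝ) * -(1 + H) = -(2 + 2 * H) := by push_cast; ring
    rw [this]
    field_simp
  simp_rw [h1]
  have hmeas : Measurable (Function.uncurry fun (l : Plane) (t : ℝ) =>
      ENNReal.ofReal (t ^ H * ((1 - Real.cos (inner ℝ h l)) * Real.exp (-(t * ‖l‖ ^ 2))))) := by
    refine Measurable.ennreal_ofReal ?_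
    fun_prop
  rw [lintegral_const_mul _ hmeas.lintegral_prod_right, lintegral_lintegral_swap hmeas.aemeasurable]
  have h3 : ∀ t ∈ Set.Ioi (0 : ℝ), ∫⁻ l : Plane,
      ENNReal.ofReal (t ^ H * ((1 - Real.cos (inner ℝ h l)) * Real.exp (-(t * ‖l‖ ^ 2)))) =
      ENNReal.ofReal Real.pi *
        ENNReal.ofReal (t ^ (H - 1) * (1 - Real.exp (-(‖h‖ ^ 2 / 4 / t)))) := by
    intro t ht
    have ht : (0 : ℝ) < t := ht
    simp_rw [ENNReal.ofReal_mul (Real.rpow_nonneg ht.le H)]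
    rw [lintegral_const_mul _ (by fun_prop), lintegral_one_sub_cos_mul_exp h ht,
      ← ENNReal.ofReal_mul (by positivity), ← ENNReal.ofReal_mul Real.pi_pos.le]
    congr 1
    rw [Real.rpow_sub_one ht.ne']
    ring
  rw [setLIntegral_congr_fun measurableSet_Ioi h3, lintegral_const_mul _ (by fun_prop),
    lintegral_rpow_mul_one_sub_exp_neg_div hH hH1 (by positivity),
    ← ENNReal.ofReal_mul Real.pi_pos.le, ← ENNReal.ofReal_mul (by positivity)]
  congr 1
  ring

lemma Gamma_neg_eq {H : ℝ} (hH : 0 < H) : Real.Gamma (-H) = -(Real.Gamma (1 - H) / H) := by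
  have := Real.Gamma_add_one (s := -H) (by linarith)
  rw [show -H + 1 = 1 - H by ring] at this
  rw [this]
  field_simp

lemma specDensity_nonneg {φ₁ φ₂ : ℝ} (hφ₁ : 0 < φ₁) (hφ₂ : 0 < φ₂) (l : Plane) :
    0 ≤ specDensity φ₁ φ₂ l := by
  have : 0 < Real.Gamma (1 + φ₂) := Real.Gamma_pos_of_pos (by linarith)
  unfold specDensity
  positivity

@[fun_prop]
lemma measurable_specDensity (φ₁ φ₂ : ℝ) : Measurable (specDensity φ₁ φ₂) := by
  unfold specDensity
  fun_prop

/-- This fixes the constant in `specDensity`. The minus sign makes the right-hand side nonnegative,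
since `Γ(-φ₂) < 0`. -/
lemma lintegral_one_sub_cos_mul_specDensity {φ₁ φ₂ : ℝ} (hφ₁ : 0 < φ₁) (hφ₂ : 0 < φ₂)
    (hφ₂' : φ₂ < 1) (h : Plane) :
    ∫⁻ l : Plane, ENNReal.ofReal ((1 - Real.cos (inner ℝ h l)) * specDensity φ₁ φ₂ l) =
      ENNReal.ofReal ((2 * Real.pi) ^ 2 * -genCov φ₁ φ₂ h) := by
  have hG : 0 < Real.Gamma (1 + φ₂) := Real.Gamma_pos_of_pos (by linarith)
  set c : ℝ := (2 : ℝ) ^ (2 * φ₂ + 2) * Real.pi * Real.Gamma (1 + φ₂) * φ₁ with hc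
  have hc0 : 0 < c := by positivity
  have h1 : ∀ l : Plane, ENNReal.ofReal ((1 - Real.cos (inner ℝ h l)) * specDensity φ₁ φ₂ l) =
      ENNReal.ofReal c *
        ENNReal.ofReal ((1 - Real.cos (inner ℝ h l)) * ‖l‖ ^ (-(2 + 2 * φ₂))) := by
    intro l
    rw [← ENNReal.ofReal_mul hc0.le]
    congr 1
    simp only [specDensity, hc]
    ring
  simp_rw [h1]
  rw [lintegral_const_mul _ (by fun_prop), lintegral_one_sub_cos_mul_norm_rpow hφ₂ hφ₂',
    ← ENNReal.ofReal_mul hc0.le]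
  congr 1
  rw [genCov, Gamma_neg_eq hφ₂, hc]
  have h2 : (‖h‖ ^ 2 / 4) ^ φ₂ = ‖h‖ ^ (2 * φ₂) / (2 : ℝ) ^ (2 * φ₂) := by
    rw [Real.div_rpow (by positivity) (by norm_num), Real.rpow_mul (norm_nonneg _),
      Real.rpow_mul (by norm_num)]
    norm_num
  rw [h2, Real.rpow_add (by norm_num)]
  have : (0 : ℝ) < (2 : ℝ) ^ (2 * φ₂) := by positivity
  norm_num
  field_simp
  norm_num

lemma integrable_one_sub_cos_mul_specDensity {φ₁ φ₂ : ℝ} (hφ₁ : 0 < φ₁) (hφ₂ : 0 < φ₂)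
    (hφ₂' : φ₂ < 1) (h : Plane) :
    Integrable fun l : Plane => (1 - Real.cos (inner ℝ h l)) * specDensity φ₁ φ₂ l := by
  refine ⟨Measurable.aestronglyMeasurable (by fun_prop), ?_⟩
  rw [hasFiniteIntegral_iff_ofReal, lintegral_one_sub_cos_mul_specDensity hφ₁ hφ₂ hφ₂']
  · exact ENNReal.ofReal_lt_top
  · exact ae_of_all _ fun l => mul_nonneg (by linarith [Real.cos_le_one (inner ℝ h l)])
      (specDensity_nonneg hφ₁ hφ₂ l)

lemma integral_one_sub_cos_mul_specDensity {φ₁ φ₂ : ℝ} (hφ₁ : 0 < φ₁) (hφ₂ : 0 < φ₂)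
    (hφ₂' : φ₂ < 1) (h : Plane) :
    ∫ l : Plane, (1 - Real.cos (inner ℝ h l)) * specDensity φ₁ φ₂ l =
      (2 * Real.pi) ^ 2 * -genCov φ₁ φ₂ h := by
  rw [integral_eq_lintegral_of_nonneg_ae, lintegral_one_sub_cos_mul_specDensity hφ₁ hφ₂ hφ₂',
    ENNReal.toReal_ofReal]
  · rw [genCov, Gamma_neg_eq hφ₂]
    have : 0 < Real.Gamma (1 - φ₂) := Real.Gamma_pos_of_pos (by linarith)
    have h2 : -(φ₁ * -(Real.Gamma (1 - φ₂) / φ₂) * ‖h‖ ^ (2 * φ₂)) =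
      φ₁ * (Real.Gamma (1 - φ₂) / φ₂) * ‖h‖ ^ (2 * φ₂) := by ring
    rw [h2]
    positivity
  · exact ae_of_all _ fun l => mul_nonneg (by linarith [Real.cos_le_one (inner ℝ h l)])
      (specDensity_nonneg hφ₁ hφ₂ l)
  · exact Measurable.aestronglyMeasurable (by fun_prop)

/-! ### Unfolding the plane over the torus -/

/-- The lattice vector `2π m`. -/
noncomputable def freqShift (m : ℤ × ℤ) : Plane := !₂[2 * Real.pi * (m.1 : ℝ), 2 * Real.pi * (m.2 : ℝ)]

lemma shiftFreq_eq (l : Plane) (m : ℤ × ℤ) : shiftFreq l m = l + freqShift m := by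
  ext i
  fin_cases i <;> simp [shiftFreq, freqShift]

lemma freqShift_add (m k : ℤ × ℤ) : freqShift (m + k) = freqShift m + freqShift k := by
  ext i
  fin_cases i <;> simp [freqShift, mul_add]

lemma measurableSet_torus : MeasurableSet torus := by
  have : torus = ⋂ i : Fin 2, (fun l : Plane => l i) ⁻¹' Set.Ioc (-Real.pi) Real.pi := by
    ext l; simp [torus]
  rw [this]
  exact MeasurableSet.iInter fun i => measurableSet_Ioc.preimage (by fun_prop)

lemma existsUnique_sub_freqShift_mem_torus (l : Plane) : ∃! m : ℤ × ℤ, l - freqShift m ∈ torus := by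
  have h : ∀ x : ℝ, ∃! k : ℤ, x - 2 * Real.pi * (k : ℝ) ∈ Set.Ioc (-Real.pi) Real.pi := by
    intro x
    obtain ⟨k, hk, hu⟩ := existsUnique_add_zsmul_mem_Ioc Real.two_pi_pos x (-Real.pi)
    rw [show -Real.pi + 2 * Real.pi = Real.pi by ring] at hk
    refine ⟨-k, ?_, fun j hj => ?_⟩
    · convert hk using 1
      simp; ring_nf
    · have := hu (-j) (by
        rw [show -Real.pi + 2 * Real.pi = Real.pi by ring]
        convert hj using 1
        simp; ring_nf)
      simp [← this]
  obtain ⟨m1, h1, u1⟩ := h (l 0)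
  obtain ⟨m2, h2, u2⟩ := h (l 1)
  refine ⟨(m1, m2), ?_, ?_⟩
  · intro i
    fin_cases i
    · simpa [freqShift] using h1
    · simpa [freqShift] using h2
  · intro m hm
    have e1 := u1 m.1 (by simpa [freqShift] using hm 0)
    have e2 := u2 m.2 (by simpa [freqShift] using hm 1)
    exact Prod.ext e1 e2

/-- The translate of the torus by `2π m`. -/
def torusCell (m : ℤ × ℤ) : Set Plane := (fun l => l + -freqShift m) ⁻¹' torus

lemma measurableSet_torusCell (m : ℤ × ℤ) : MeasurableSet (torusCell m) :=
  measurableSet_torus.preimage (by fun_prop)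

lemma pairwise_disjoint_torusCell : Pairwise (Function.onFun Disjoint torusCell) := by
  intro m k hmk
  refine Set.disjoint_left.2 fun l hl hl' => hmk ?_
  simp only [torusCell, Set.mem_preimage, ← sub_eq_add_neg] at hl hl'
  exact (existsUnique_sub_freqShift_mem_torus l).unique hl hl'

lemma iUnion_torusCell : ⋃ m, torusCell m = Set.univ := by
  refine Set.eq_univ_of_forall fun l => ?_
  obtain ⟨m, hm, -⟩ := existsUnique_sub_freqShift_mem_torus l
  exact Set.mem_iUnion.2 ⟨m, by simpa [torusCell, ← sub_eq_add_neg] using hm⟩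

/-- The half-open cells `torus + 2π m` tile the plane, and each is moved back to the torus by
translation invariance. -/
lemma lintegral_eq_lintegral_torus_tsum {F : Plane → ENNReal} (hF : Measurable F) :
    ∫⁻ l, F l = ∫⁻ l in torus, ∑' m : ℤ × ℤ, F (shiftFreq l m) := by
  have hs : ∀ m, Measurable fun l => F (shiftFreq l m) := fun m => by
    simp_rw [shiftFreq_eq]
    exact hF.comp (by fun_prop)
  rw [lintegral_tsum fun m => (hs m).aemeasurable, ← setLIntegral_univ, ← iUnion_torusCell,
    lintegral_iUnion measurableSet_torusCell pairwise_disjoint_torusCell]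
  refine tsum_congr fun m => ?_
  have h := (measurePreserving_add_right (volume : Measure Plane)
    (-freqShift m)).setLIntegral_comp_preimage measurableSet_torus (hs m)
  rw [← h]
  refine lintegral_congr fun l => ?_
  simp [shiftFreq_eq]

lemma integral_eq_integral_torus_tsum {F : Plane → ℂ} (hF : Measurable F) (hi : Integrable F) :
    ∫ l, F l = ∫ l in torus, ∑' m : ℤ × ℤ, F (shiftFreq l m) := by
  have hs : ∀ m, Measurable fun l => F (shiftFreq l m) := fun m => by
    simp_rw [shiftFreq_eq]
    exact hF.comp (by fun_prop)
  rw [integral_tsum (fun m => (hs m).aestronglyMeasurable), ← setIntegral_univ, ← iUnion_torusCell,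
    integral_iUnion measurableSet_torusCell pairwise_disjoint_torusCell hi.integrableOn]
  · refine tsum_congr fun m => ?_
    have h := (measurePreserving_add_right (volume : Measure Plane)
      (-freqShift m)).setIntegral_preimage_emb (measurableEmbedding_addRight _)
      (fun l => F (shiftFreq l m)) torus
    rw [← h]
    refine integral_congr_ae (ae_of_all _ fun l => ?_)
    simp [shiftFreq_eq]
  · have h := lintegral_eq_lintegral_torus_tsum (F := fun l => ‖F l‖ₑ) (by fun_prop)
    rw [← lintegral_tsum fun m => (hs m).enorm.aemeasurable, ← h]
    exact hi.hasFiniteIntegral.ne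

/-! ### The aliased spectral density -/

/-- Here `‖m‖` is the sup norm on `ℤ × ℤ`, and the threshold 2 is the dimension; this is the
convergence used for Eisenstein series. -/
lemma summable_norm_rpow_lattice {k : ℝ} (hk : 2 < k) :
    Summable fun m : ℤ × ℤ => ‖m‖ ^ (-k) := by
  rw [← (finTwoArrowEquiv ℤ).summable_iff]
  refine (EisensteinSeries.summable_one_div_norm_rpow hk).congr fun x => ?_
  simp only [Function.comp_apply, finTwoArrowEquiv_apply]
  congr 1
  simp [Pi.norm_def, Prod.norm_def, Fin.univ_succ]

/-- In the coordinate that attains `‖m‖`, `|x + 2π k| ≥ 2π |k| - π ≥ π |k|` because `|x| ≤ π` and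
`|k| ≥ 1`. -/
lemma pi_mul_norm_le_norm_shiftFreq {l : Plane} (hl : l ∈ torus) {m : ℤ × ℤ} (hm : m ≠ 0) :
    Real.pi * ‖m‖ ≤ ‖shiftFreq l m‖ := by
  have key : ∀ (x : ℝ) (k : ℤ), x ∈ Set.Ioc (-Real.pi) Real.pi → k ≠ 0 →
      Real.pi * ‖k‖ ≤ |x + 2 * Real.pi * (k : ℝ)| := by
    intro x k hx hk
    have h1 : (1 : ℝ) ≤ |(k : ℝ)| := by
      rw [← Int.cast_abs]; exact_mod_cast Int.one_le_abs hk
    have h2 : |x| ≤ Real.pi := abs_le.2 ⟨hx.1.le, hx.2⟩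
    have h3 := abs_sub_abs_le_abs_add (2 * Real.pi * (k : ℝ)) x
    rw [abs_mul, abs_of_pos Real.two_pi_pos, add_comm] at h3
    rw [Int.norm_eq_abs]
    nlinarith [Real.pi_pos]
  have c0 : |l 0 + 2 * Real.pi * (m.1 : ℝ)| ≤ ‖shiftFreq l m‖ := by
    simpa [shiftFreq] using PiLp.norm_apply_le (shiftFreq l m) 0
  have c1 : |l 1 + 2 * Real.pi * (m.2 : ℝ)| ≤ ‖shiftFreq l m‖ := by
    simpa [shiftFreq] using PiLp.norm_apply_le (shiftFreq l m) 1
  rw [Prod.norm_def]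
  rcases le_total ‖m.1‖ ‖m.2‖ with h | h
  · rw [max_eq_right h]
    refine (key _ _ (hl 1) fun h0 => hm ?_).trans c1
    rw [h0, norm_zero] at h
    exact Prod.ext (norm_le_zero_iff.1 h) h0
  · rw [max_eq_left h]
    refine (key _ _ (hl 0) fun h0 => hm ?_).trans c0
    rw [h0, norm_zero] at h
    exact Prod.ext h0 (norm_le_zero_iff.1 h)

/-- The constant `2^(2 φ₂ + 2) π Γ(1 + φ₂) φ₁` of the spectral density. -/
noncomputable def specConst (φ₁ φ₂ : ℝ) : ℝ := (2 : ℝ) ^ (2 * φ₂ + 2) * Real.pi * Real.Gamma (1 + φ₂) * φ₁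

lemma specConst_nonneg {φ₁ φ₂ : ℝ} (hφ₁ : 0 < φ₁) (hφ₂ : 0 < φ₂) : 0 ≤ specConst φ₁ φ₂ := by
  have : 0 < Real.Gamma (1 + φ₂) := Real.Gamma_pos_of_pos (by linarith)
  unfold specConst
  positivity

lemma specDensity_shiftFreq_le {φ₁ φ₂ : ℝ} (hφ₁ : 0 < φ₁) (hφ₂ : 0 < φ₂) {l : Plane}
    (hl : l ∈ torus) {m : ℤ × ℤ} (hm : m ≠ 0) :
    specDensity φ₁ φ₂ (shiftFreq l m) ≤
      specConst φ₁ φ₂ * Real.pi ^ (-(2 + 2 * φ₂)) * ‖m‖ ^ (-(2 + 2 * φ₂)) := by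
  have h := pi_mul_norm_le_norm_shiftFreq hl hm
  have hm' : 0 < ‖m‖ := norm_pos_iff.2 hm
  rw [mul_assoc, ← Real.mul_rpow Real.pi_pos.le hm'.le]
  exact mul_le_mul_of_nonneg_left
    (Real.rpow_le_rpow_of_nonpos (by positivity) h (by linarith)) (specConst_nonneg hφ₁ hφ₂)

/-- Reindexing by a lattice shift brings `l` into the torus, where every term except `m = 0` has the
lattice bound. -/
lemma summable_specDensity_shiftFreq {φ₁ φ₂ : ℝ} (hφ₁ : 0 < φ₁) (hφ₂ : 0 < φ₂) (l : Plane) :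
    Summable fun m : ℤ × ℤ => specDensity φ₁ φ₂ (shiftFreq l m) := by
  obtain ⟨k, hk, -⟩ := existsUnique_sub_freqShift_mem_torus l
  rw [← (Equiv.addRight (-k)).summable_iff]
  have hs := (summable_norm_rpow_lattice (k := 2 + 2 * φ₂) (by linarith)).mul_left
    (specConst φ₁ φ₂ * Real.pi ^ (-(2 + 2 * φ₂)))
  refine Summable.of_norm_bounded_eventually hs ?_
  filter_upwards [(Set.finite_singleton (0 : ℤ × ℤ)).compl_mem_cofinite] with m hm
  have h1 : shiftFreq l (m + -k) = shiftFreq (l - freqShift k) m := by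
    have h0 : freqShift (-k) = -freqShift k := by
      ext i; fin_cases i <;> simp [freqShift]
    rw [shiftFreq_eq, shiftFreq_eq, freqShift_add, h0]; abel
  rw [Function.comp_apply, Equiv.coe_addRight, h1, Real.norm_of_nonneg (specDensity_nonneg hφ₁ hφ₂ _)]
  exact specDensity_shiftFreq_le hφ₁ hφ₂ hk hm

lemma latticeSpec_nonneg {φ₁ φ₂ : ℝ} (hφ₁ : 0 < φ₁) (hφ₂ : 0 < φ₂) (l : Plane) :
    0 ≤ latticeSpec φ₁ φ₂ l :=
  tsum_nonneg fun _ => specDensity_nonneg hφ₁ hφ₂ _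

@[fun_prop]
lemma measurable_latticeSpec (φ₁ φ₂ : ℝ) : Measurable (latticeSpec φ₁ φ₂) := by
  unfold latticeSpec
  refine Measurable.tsum fun m => ?_
  simp_rw [shiftFreq_eq]
  fun_prop

@[fun_prop]
lemma measurable_symbolOne : Measurable symbolOne := by
  unfold symbolOne
  fun_prop

lemma diffSpec_nonneg {φ₁ φ₂ : ℝ} (hφ₁ : 0 < φ₁) (hφ₂ : 0 < φ₂) (l : Plane) :
    0 ≤ diffSpec φ₁ φ₂ l :=
  mul_nonneg (sq_nonneg _) (latticeSpec_nonneg hφ₁ hφ₂ l)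

@[fun_prop]
lemma measurable_diffSpec (φ₁ φ₂ : ℝ) : Measurable (diffSpec φ₁ φ₂) := by
  unfold diffSpec
  fun_prop

/-- The term `m = 0` is at most a constant times `‖l‖⁴ ‖l‖^(-(2 + 2φ₂)) = ‖l‖^(2 - 2φ₂)`, bounded on
the torus as the exponent is positive. The other terms form a uniformly convergent series,
multiplied by a squared symbol of at most 16. -/
lemma exists_diffSpec_le {φ₁ φ₂ : ℝ} (hφ₁ : 0 < φ₁) (hφ₂ : 0 < φ₂) (hφ₂' : φ₂ < 1) :
    ∃ M, ∀ l ∈ torus, diffSpec φ₁ φ₂ l ≤ M := by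
  set c := specConst φ₁ φ₂ with hc
  have hc0 : 0 ≤ c := specConst_nonneg hφ₁ hφ₂
  set g : ℤ × ℤ → ℝ := fun m => c * Real.pi ^ (-(2 + 2 * φ₂)) * ‖m‖ ^ (-(2 + 2 * φ₂)) with hg
  have hgs : Summable g :=
    (summable_norm_rpow_lattice (k := 2 + 2 * φ₂) (by linarith)).mul_left _
  refine ⟨c * (2 * Real.pi) ^ (2 - 2 * φ₂) + 16 * ∑' m, g m, fun l hl => ?_⟩
  have hsum := summable_specDensity_shiftFreq hφ₁ hφ₂ l
  have hchar : ∀ x : ℝ, ‖1 - Complex.exp (Complex.I * (x : ℂ))‖ ≤ |x| ∧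
      ‖1 - Complex.exp (Complex.I * (x : ℂ))‖ ≤ 2 := by
    intro x
    refine ⟨?_, ?_⟩
    · rw [norm_sub_rev]
      exact Real.norm_exp_I_mul_ofReal_sub_one_le
    · refine (norm_sub_le _ _).trans ?_
      rw [mul_comm, Complex.norm_exp_ofReal_mul_I]
      norm_num
  have hS1 : ‖symbolOne l‖ ≤ ‖l‖ * ‖l‖ := by
    rw [symbolOne, norm_mul]
    exact mul_le_mul ((hchar _).1.trans (PiLp.norm_apply_le l 0))
      ((hchar _).1.trans (PiLp.norm_apply_le l 1)) (norm_nonneg _) (norm_nonneg _)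
  have hS2 : ‖symbolOne l‖ ≤ 2 * 2 := by
    rw [symbolOne, norm_mul]
    exact mul_le_mul (hchar _).2 (hchar _).2 (norm_nonneg _) (by norm_num)
  have hnorm : ‖l‖ ≤ 2 * Real.pi := by
    rw [EuclideanSpace.norm_eq]
    refine Real.sqrt_le_iff.2 ⟨by positivity, ?_⟩
    simp only [Fin.sum_univ_two, Real.norm_eq_abs, sq_abs]
    have h0 := hl 0
    have h1 := hl 1
    nlinarith [sq_le_sq' h0.1.le h0.2, sq_le_sq' h1.1.le h1.2]
  rw [diffSpec, latticeSpec, hsum.tsum_eq_add_tsum_ite 0, mul_add]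
  refine add_le_add ?_ ?_
  · have h0 : shiftFreq l 0 = l := by
      ext i; fin_cases i <;> simp [shiftFreq]
    rw [h0]
    rcases eq_or_ne l 0 with rfl | hl0
    · have : symbolOne 0 = 0 := by simp [symbolOne]
      rw [this]
      simp only [norm_zero, ne_eq, OfNat.ofNat_ne_zero, not_false_eq_true, zero_pow, zero_mul]
      positivity
    · have hl1 : 0 < ‖l‖ := norm_pos_iff.2 hl0
      calc ‖symbolOne l‖ ^ 2 * specDensity φ₁ φ₂ l
          ≤ (‖l‖ * ‖l‖) ^ 2 * specDensity φ₁ φ₂ l := by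
            gcongr
            exact specDensity_nonneg hφ₁ hφ₂ l
        _ = c * ‖l‖ ^ (2 - 2 * φ₂) := by
            have : (‖l‖ * ‖l‖) ^ 2 = ‖l‖ ^ (4 : ℝ) := by
              rw [show (4 : ℝ) = ((4 : ℕ) : ℝ) by norm_num, Real.rpow_natCast]; ring
            rw [this, specDensity, hc, specConst, mul_left_comm, ← Real.rpow_add hl1]
            congr 2
            ring
        _ ≤ _ := by
            gcongr
            linarith
  · refine mul_le_mul ?_ ?_ (tsum_nonneg fun m => ?_) (by norm_num)
    · calc ‖symbolOne l‖ ^ 2 ≤ (2 * 2) ^ 2 := by gcongr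
        _ = 16 := by norm_num
    · refine Summable.tsum_le_tsum (fun m => ?_) ?_ hgs
      · split_ifs with hm
        · simp only [hg]; positivity
        · exact specDensity_shiftFreq_le hφ₁ hφ₂ hl hm
      · refine Summable.of_nonneg_of_le (fun m => ?_) (fun m => ?_) hsum
        · split_ifs
          · exact le_rfl
          · exact specDensity_nonneg hφ₁ hφ₂ _
        · split_ifs
          · exact specDensity_nonneg hφ₁ hφ₂ _
          · exact le_rfl
    · split_ifs
      · exact le_rfl
      · exact specDensity_nonneg hφ₁ hφ₂ _

/-! ### Fourier analysis on the torus -/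

/-- The half-open unit cube centred at the origin. -/
def unitCube : Set (Fin 2 → ℝ) := {x | ∀ i, x i ∈ Set.Ioc (-(1 / 2) : ℝ) (-(1 / 2) + 1)}

-- Rescaling by `2π` absorbs the factor `(2π)⁻²` and leads to the unit cube, the fundamental domain
-- of `UnitAddTorus` used for Parseval.
open scoped Pointwise in
lemma integral_torusMeasure {E : Type*} [NormedAddCommGroup E] [NormedSpace ℝ E] (G : Plane → E) :
    ∫ l, G l ∂torusMeasure = ∫ x in unitCube, G (WithLp.toLp 2 ((2 * Real.pi) • x)) := by
  have h1 := (PiLp.volume_preserving_toLp (Fin 2)).setIntegral_preimage_emb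
    (MeasurableEquiv.toLp 2 (Fin 2 → ℝ)).measurableEmbedding G torus
  have h2 := Measure.setIntegral_comp_smul_of_pos (volume : Measure (Fin 2 → ℝ))
    (fun y => G (WithLp.toLp 2 y)) unitCube Real.two_pi_pos
  have h3 : (2 * Real.pi) • unitCube = (WithLp.toLp 2 : (Fin 2 → ℝ) → Plane) ⁻¹' torus := by
    ext y
    rw [Set.mem_smul_set_iff_inv_smul_mem₀ Real.two_pi_pos.ne']
    simp only [unitCube, torus, Set.mem_ofPred_eq, Set.mem_preimage, Pi.smul_apply, smul_eq_mul]
    refine forall_congr' fun i => ?_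
    simp only [Set.mem_Ioc]
    have hp := Real.pi_pos
    rw [inv_mul_eq_div, lt_div_iff₀ Real.two_pi_pos, div_le_iff₀ Real.two_pi_pos]
    constructor <;> rintro ⟨a, b⟩ <;> constructor <;> linarith
  rw [h2, h3, h1, torusMeasure, integral_smul_measure, ENNReal.toReal_ofReal (by positivity)]
  simp

instance isProbabilityMeasure_torusMeasure : IsProbabilityMeasure torusMeasure := by
  have hf : IsFiniteMeasure torusMeasure := by
    have : Bornology.IsBounded torus := by
      refine (Metric.isBounded_closedBall (x := (0 : Plane)) (r := 2 * Real.pi)).subset ?_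
      intro l hl
      rw [mem_closedBall_zero_iff, EuclideanSpace.norm_eq]
      refine Real.sqrt_le_iff.2 ⟨by positivity, ?_⟩
      simp only [Fin.sum_univ_two, Real.norm_eq_abs, sq_abs]
      have h0 := hl 0
      have h1 := hl 1
      nlinarith [sq_le_sq' h0.1.le h0.2, sq_le_sq' h1.1.le h1.2]
    have hfin : IsFiniteMeasure ((volume : Measure Plane).restrict torus) :=
      ⟨by simpa using this.measure_lt_top⟩
    exact Measure.smul_finite _ ENNReal.ofReal_ne_top
  have h := integral_torusMeasure fun _ => (1 : ℝ)
  have hc : unitCube = Set.univ.pi fun _ : Fin 2 => Set.Ioc (-(1 / 2) : ℝ) (-(1 / 2) + 1) := by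
    ext; simp [unitCube]
  simp only [integral_const, smul_eq_mul, mul_one, measureReal_restrict_apply_univ] at h
  rw [hc, measureReal_def, measureReal_def, Real.volume_pi_Ioc] at h
  refine ⟨?_⟩
  rw [← ENNReal.toReal_eq_one_iff, h]
  simp

/-- The character `l ↦ exp (i ⟨h, l⟩)`, for `h ∈ ℤ²`. -/
noncomputable def latticeChar (h : ℤ × ℤ) (l : Plane) : ℂ :=
  Complex.exp (Complex.I * ((h.1 * l 0 + h.2 * l 1 : ℝ) : ℂ))

@[fun_prop]
lemma measurable_latticeChar (h : ℤ × ℤ) : Measurable (latticeChar h) := by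
  unfold latticeChar
  fun_prop

lemma norm_latticeChar (h : ℤ × ℤ) (l : Plane) : ‖latticeChar h l‖ = 1 := by
  rw [latticeChar, mul_comm, Complex.norm_exp_ofReal_mul_I]

lemma latticeChar_zero (l : Plane) : latticeChar 0 l = 1 := by simp [latticeChar]

lemma latticeChar_add (h k : ℤ × ℤ) (l : Plane) :
    latticeChar (h + k) l = latticeChar h l * latticeChar k l := by
  rw [latticeChar, latticeChar, latticeChar, ← Complex.exp_add, ← mul_add, ← Complex.ofReal_add]
  congr 3
  simp
  ring

lemma conj_latticeChar (h : ℤ × ℤ) (l : Plane) :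
    (starRingEnd ℂ) (latticeChar h l) = latticeChar (-h) l := by
  rw [latticeChar, latticeChar, ← Complex.exp_conj]
  congr 1
  rw [map_mul, Complex.conj_I, Complex.conj_ofReal, neg_mul, ← mul_neg, ← Complex.ofReal_neg]
  congr 2
  simp
  ring

section

noncomputable local instance : MeasureSpace UnitAddCircle := ⟨AddCircle.haarAddCircle⟩

local instance : IsProbabilityMeasure (volume : Measure UnitAddCircle) :=
  inferInstanceAs (IsProbabilityMeasure AddCircle.haarAddCircle)

/-- **Parseval's identity** on the torus `(-π, π]²`. -/
lemma hasSum_sq_norm_fourier {g : Plane → ℂ} (hg : Measurable g) {C : ℝ}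
    (hC : ∀ l ∈ torus, ‖g l‖ ≤ C) :
    HasSum (fun h : ℤ × ℤ => ‖∫ l, latticeChar h l * g l ∂torusMeasure‖ ^ 2)
      (∫ l, ‖g l‖ ^ 2 ∂torusMeasure) := by
  -- `ψ` picks the representative in the half-open cell, so it lands in the torus everywhere and the
  -- bound on `g` needs no exceptional set.
  set ψ : UnitAddTorus (Fin 2) → Plane := fun x =>
    WithLp.toLp 2 ((2 * Real.pi) • fun i => (AddCircle.equivIoc 1 (-(1 / 2) : ℝ) (x i)).1) with hψ
  have hψm : Measurable ψ := by
    have h1 : Measurable fun (x : UnitAddTorus (Fin 2)) (i : Fin 2) =>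
        (AddCircle.equivIoc 1 (-(1 / 2) : ℝ) (x i)).1 :=
      measurable_pi_lambda _ fun i => measurable_subtype_coe.comp
        ((AddCircle.measurableEquivIoc 1 (-(1 / 2) : ℝ)).measurable.comp (measurable_pi_apply i))
    exact (WithLp.measurable_toLp 2 _).comp (h1.const_smul (2 * Real.pi))
  have hψt : ∀ x, ψ x ∈ torus := by
    intro x i
    have h := (AddCircle.equivIoc 1 (-(1 / 2) : ℝ) (x i)).2
    simp only [hψ, Pi.smul_apply, smul_eq_mul, Set.mem_Ioc] at h ⊢
    constructor <;> nlinarith [Real.pi_pos]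
  have hψc : ∀ x ∈ unitCube, ψ (fun i => (x i : UnitAddCircle)) =
      WithLp.toLp 2 ((2 * Real.pi) • x) := by
    intro x hx
    simp only [hψ]
    congr 2
    funext i
    exact AddCircle.equivIoc_coe_of_mem (hx i)
  have hmem : MemLp (fun x => g (ψ x)) 2 (volume : Measure (UnitAddTorus (Fin 2))) :=
    MemLp.of_bound (hg.comp hψm).aestronglyMeasurable C (ae_of_all _ fun x => hC _ (hψt x))
  have hcube : MeasurableSet unitCube := by
    have hc : unitCube = Set.univ.pi fun _ : Fin 2 => Set.Ioc (-(1 / 2) : ℝ) (-(1 / 2) + 1) := by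
      ext; simp [unitCube]
    rw [hc]
    exact MeasurableSet.univ_pi fun _ => measurableSet_Ioc
  have h := UnitAddTorus.hasSum_sq_mFourierCoeff (hmem.toLp _)
  have e1 : ∫ t, ‖(hmem.toLp _ : UnitAddTorus (Fin 2) → ℂ) t‖ ^ 2 = ∫ l, ‖g l‖ ^ 2 ∂torusMeasure := by
    have : ∫ t, ‖(hmem.toLp _ : UnitAddTorus (Fin 2) → ℂ) t‖ ^ 2 = ∫ t, ‖g (ψ t)‖ ^ 2 :=
      integral_congr_ae (hmem.coeFn_toLp.mono fun t ht => by simp only [ht])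
    rw [this, UnitAddTorus.integral_preimage _ fun _ => (-(1 / 2) : ℝ), integral_torusMeasure]
    refine setIntegral_congr_fun hcube fun x hx => ?_
    simp only [hψc x hx]
  have e2 : ∀ n : Fin 2 → ℤ, UnitAddTorus.mFourierCoeff (hmem.toLp _) n =
      ∫ l, latticeChar (-(n 0), -(n 1)) l * g l ∂torusMeasure := by
    intro n
    have : UnitAddTorus.mFourierCoeff (hmem.toLp _) n =
        UnitAddTorus.mFourierCoeff (fun t => g (ψ t)) n :=
      integral_congr_ae (hmem.coeFn_toLp.mono fun t ht => by simp only [ht])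
    rw [this, UnitAddTorus.mFourierCoeff_eq_integral _ _ fun _ => (-(1 / 2) : ℝ),
      integral_torusMeasure]
    refine setIntegral_congr_fun hcube fun x hx => ?_
    simp only [hψc x hx, smul_eq_mul]
    congr 1
    rw [UnitAddTorus.mFourier, ContinuousMap.coe_mk, Fin.prod_univ_two, fourier_coe_apply,
      fourier_coe_apply, ← Complex.exp_add, latticeChar]
    congr 1
    simp
    ring
  rw [e1] at h
  simp_rw [e2] at h
  -- The Fourier coefficient at `n` pairs with the character of `-n`, hence the negation in the
  -- reindexing.
  have h' := (((finTwoArrowEquiv ℤ).symm.trans (Equiv.neg _)).hasSum_iff).2 h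
  refine h'.congr_fun fun m => ?_
  simp

end

/-- Parseval for the constant 1: the coefficient at `0` already exhausts the total mass 1, so every
other one is zero. -/
lemma integral_latticeChar (h : ℤ × ℤ) :
    ∫ l, latticeChar h l ∂torusMeasure = if h = 0 then 1 else 0 := by
  split_ifs with h0
  · subst h0
    simp [latticeChar_zero]
  · have hs := hasSum_sq_norm_fourier (g := fun _ => 1) measurable_const (C := 1) (by simp)
    simp only [mul_one, norm_one, one_pow, integral_const, probReal_univ, smul_eq_mul] at hs
    have h2 := hs.summable.sum_le_tsum {0, h} fun _ _ => by positivity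
    rw [hs.tsum_eq, Finset.sum_pair (Ne.symm h0)] at h2
    simp only [latticeChar_zero, integral_const, probReal_univ, one_smul, norm_one, one_pow] at h2
    have h3 : ‖∫ l, latticeChar h l ∂torusMeasure‖ ^ 2 = 0 :=
      le_antisymm (by linarith) (by positivity)
    simpa using h3

/-! ### Cross-covariances of the bilinear differences -/

/-- The sign of a corner of the unit square in the bilinear difference. -/
def cornerSign (a : Fin 2 × Fin 2) : ℝ := (-1) ^ (a.1.val + a.2.val)

lemma sum_cornerSign : ∑ a, cornerSign a = 0 := by
  simp [Fintype.sum_prod_type, cornerSign]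

lemma bilinDiff_eq_sum (r : ℕ) (x : ℕ × ℕ → ℝ) (t : ℕ × ℕ) :
    bilinDiff r x t =
      ∑ a : Fin 2 × Fin 2, cornerSign a * x (t.1 + r * a.1.val, t.2 + r * a.2.val) := by
  simp [Fintype.sum_prod_type, cornerSign, bilinDiff]
  ring

/-- The lag between the corners `a` and `b` of squares of steps `i + 1` and `j + 1` at lag `h`. -/
def cornerLag (i j : Fin 2) (h : ℤ × ℤ) (a b : Fin 2 × Fin 2) : ℤ × ℤ :=
  (h.1 + (i.val + 1) * a.1.val - (j.val + 1) * b.1.val,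
    h.2 + (i.val + 1) * a.2.val - (j.val + 1) * b.2.val)

/-- A lattice point as a point of the plane. -/
def latticePoint (h : ℤ × ℤ) : Plane := !₂[(h.1 : ℝ), (h.2 : ℝ)]

/-- The covariance at lag `h` between the bilinear differences of steps `i + 1` and `j + 1`. -/
noncomputable def crossCov (φ₁ φ₂ : ℝ) (i j : Fin 2) (h : ℤ × ℤ) : ℝ :=
  ∑ a, ∑ b, cornerSign a * cornerSign b * genCov φ₁ φ₂ (latticePoint (cornerLag i j h a b))

/-- The symbol `(1 - e^{i r λ₁}) (1 - e^{i r λ₂})`, `r = i + 1`, of the bilinear difference. -/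
noncomputable def stepSymbol (i : Fin 2) (l : Plane) : ℂ :=
  (1 - latticeChar ((i.val : ℤ) + 1, 0) l) * (1 - latticeChar (0, (i.val : ℤ) + 1) l)

@[fun_prop]
lemma measurable_stepSymbol (i : Fin 2) : Measurable (stepSymbol i) := by
  unfold stepSymbol
  fun_prop

lemma norm_one_add_exp_sq (x : ℝ) :
    ‖1 + Complex.exp (Complex.I * (x : ℂ))‖ ^ 2 = 4 * Real.cos (x / 2) ^ 2 := by
  rw [← Complex.normSq_eq_norm_sq, mul_comm, Complex.exp_mul_I, ← Complex.ofReal_cos,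
    ← Complex.ofReal_sin, Complex.normSq_apply]
  simp only [Complex.add_re, Complex.add_im, Complex.one_re, Complex.one_im, Complex.ofReal_re,
    Complex.ofReal_im, Complex.re_ofReal_mul, Complex.im_ofReal_mul, Complex.I_re, Complex.I_im]
  have h1 := Real.cos_sq (x / 2)
  rw [show 2 * (x / 2) = x by ring] at h1
  have h2 := Real.sin_sq_add_cos_sq x
  rw [h1]
  linear_combination h2

/-- For step 2, `1 - e^(2ix) = (1 - e^(ix))(1 + e^(ix))` and `|1 + e^(ix)|² = 4 cos²(x/2)` in each
coordinate. -/
lemma norm_stepSymbol_sq (i : Fin 2) (l : Plane) :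
    ‖stepSymbol i l‖ ^ 2 = bSymbol i l * ‖symbolOne l‖ ^ 2 := by
  fin_cases i
  · simp [stepSymbol, symbolOne, bSymbol, latticeChar]
  · have h : ∀ x : ℝ, 1 - Complex.exp (Complex.I * ((2 * x : ℝ) : ℂ)) =
        (1 - Complex.exp (Complex.I * (x : ℂ))) * (1 + Complex.exp (Complex.I * (x : ℂ))) := by
      intro x
      have : Complex.exp (Complex.I * ((2 * x : ℝ) : ℂ)) =
          Complex.exp (Complex.I * (x : ℂ)) * Complex.exp (Complex.I * (x : ℂ)) := by
        rw [← Complex.exp_add]; congr 1; push_cast; ring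
      rw [this]; ring
    have e : stepSymbol 1 l = symbolOne l * ((1 + Complex.exp (Complex.I * ((l 0 : ℝ) : ℂ))) *
        (1 + Complex.exp (Complex.I * ((l 1 : ℝ) : ℂ)))) := by
      have h0 := h (l 0)
      have h1 := h (l 1)
      simp only [stepSymbol, symbolOne, latticeChar]
      norm_num at h0 h1 ⊢
      rw [h0, h1]
      ring
    simp only [Fin.mk_one]
    rw [e, norm_mul, norm_mul, mul_pow, mul_pow, norm_one_add_exp_sq, norm_one_add_exp_sq]
    simp only [bSymbol, one_ne_zero, if_false]
    ring

lemma bSymbol_nonneg (i : Fin 2) (l : Plane) : 0 ≤ bSymbol i l := by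
  unfold bSymbol
  split_ifs <;> positivity

lemma bSymbol_le (i : Fin 2) (l : Plane) : bSymbol i l ≤ 16 := by
  unfold bSymbol
  split_ifs
  · norm_num
  · have h0 := Real.cos_sq_le_one (l 0 / 2)
    have h1 := Real.cos_sq_le_one (l 1 / 2)
    nlinarith [sq_nonneg (Real.cos (l 0 / 2)), sq_nonneg (Real.cos (l 1 / 2))]

@[fun_prop]
lemma measurable_bSymbol (i : Fin 2) : Measurable (bSymbol i) := by
  unfold bSymbol
  split_ifs <;> fun_prop

lemma norm_stepSymbol_sq_mul_latticeSpec (φ₁ φ₂ : ℝ) (i : Fin 2) (l : Plane) :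
    ‖stepSymbol i l‖ ^ 2 * latticeSpec φ₁ φ₂ l = bSymbol i l * diffSpec φ₁ φ₂ l := by
  rw [norm_stepSymbol_sq, diffSpec]; ring

lemma latticeChar_shiftFreq (h m : ℤ × ℤ) (l : Plane) :
    latticeChar h (shiftFreq l m) = latticeChar h l := by
  rw [latticeChar, latticeChar, Complex.exp_eq_exp_iff_exists_int]
  refine ⟨h.1 * m.1 + h.2 * m.2, ?_⟩
  simp [shiftFreq]
  ring

lemma stepSymbol_shiftFreq (i : Fin 2) (m : ℤ × ℤ) (l : Plane) :
    stepSymbol i (shiftFreq l m) = stepSymbol i l := by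
  simp only [stepSymbol, latticeChar_shiftFreq]

lemma latticeChar_neg_arg (h : ℤ × ℤ) (l : Plane) :
    latticeChar h (-l) = (starRingEnd ℂ) (latticeChar h l) := by
  rw [conj_latticeChar, latticeChar, latticeChar]
  congr 3
  simp

lemma stepSymbol_neg_arg (i : Fin 2) (l : Plane) :
    stepSymbol i (-l) = (starRingEnd ℂ) (stepSymbol i l) := by
  simp only [stepSymbol, latticeChar_neg_arg, map_mul, map_sub, map_one]

lemma latticeChar_re (h : ℤ × ℤ) (l : Plane) :
    (latticeChar h l).re = Real.cos (inner ℝ (latticePoint h) l) := by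
  rw [latticeChar, mul_comm, Complex.exp_ofReal_mul_I_re]
  congr 1
  simp [latticePoint, PiLp.inner_apply, Fin.sum_univ_two]
  ring

lemma stepSymbol_eq_sum (i : Fin 2) (l : Plane) :
    stepSymbol i l = ∑ a : Fin 2 × Fin 2, (cornerSign a : ℂ) *
      latticeChar (((i.val : ℤ) + 1) * a.1.val, ((i.val : ℤ) + 1) * a.2.val) l := by
  have h : latticeChar ((i.val : ℤ) + 1, (i.val : ℤ) + 1) l =
      latticeChar ((i.val : ℤ) + 1, 0) l * latticeChar (0, (i.val : ℤ) + 1) l := by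
    rw [← latticeChar_add]; simp
  have h0 : latticeChar (0, 0) l = 1 := latticeChar_zero l
  simp [Fintype.sum_prod_type, cornerSign, stepSymbol, h, h0]
  ring

lemma latticeChar_mul_stepSymbol (i j : Fin 2) (h : ℤ × ℤ) (l : Plane) :
    latticeChar h l * stepSymbol i l * (starRingEnd ℂ) (stepSymbol j l) =
      ∑ a, ∑ b, ((cornerSign a * cornerSign b : ℝ) : ℂ) * latticeChar (cornerLag i j h a b) l := by
  rw [stepSymbol_eq_sum, stepSymbol_eq_sum, map_sum, mul_assoc, Finset.sum_mul_sum,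
    Finset.mul_sum]
  refine Finset.sum_congr rfl fun a _ => ?_
  rw [Finset.mul_sum]
  refine Finset.sum_congr rfl fun b _ => ?_
  rw [map_mul, Complex.conj_ofReal, conj_latticeChar]
  have : cornerLag i j h a b = h + ((((i.val : ℤ) + 1) * a.1.val, ((i.val : ℤ) + 1) * a.2.val) +
      -(((j.val : ℤ) + 1) * b.1.val, ((j.val : ℤ) + 1) * b.2.val)) := by
    ext <;> simp [cornerLag] <;> ring
  rw [this, latticeChar_add, latticeChar_add]
  push_cast
  ring

section

variable {φ₁ φ₂ : ℝ}

/-- As the corner signs sum to zero, each cosine may be replaced by `-(1 - cos)`. Every term is then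
separately integrable against the density, which is singular at the origin. -/
lemma re_latticeChar_mul_stepSymbol (i j : Fin 2) (h : ℤ × ℤ) (l : Plane) :
    (latticeChar h l * stepSymbol i l * (starRingEnd ℂ) (stepSymbol j l)).re *
        specDensity φ₁ φ₂ l =
      ∑ a, ∑ b, -(cornerSign a * cornerSign b) *
        ((1 - Real.cos (inner ℝ (latticePoint (cornerLag i j h a b)) l)) *
          specDensity φ₁ φ₂ l) := by
  have h0 : ∑ a, ∑ b, cornerSign a * cornerSign b = 0 := by
    rw [← Finset.sum_mul_sum, sum_cornerSign, zero_mul]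
  rw [latticeChar_mul_stepSymbol, Complex.re_sum, Finset.sum_mul]
  simp only [Complex.re_sum, Complex.re_ofReal_mul, latticeChar_re]
  have h1 : ∀ a, (∑ b, cornerSign a * cornerSign b *
      Real.cos (inner ℝ (latticePoint (cornerLag i j h a b)) l)) * specDensity φ₁ φ₂ l =
      (∑ b, -(cornerSign a * cornerSign b) *
        ((1 - Real.cos (inner ℝ (latticePoint (cornerLag i j h a b)) l)) * specDensity φ₁ φ₂ l)) +
      (∑ b, cornerSign a * cornerSign b) * specDensity φ₁ φ₂ l := by
    intro a
    rw [Finset.sum_mul, Finset.sum_mul, ← Finset.sum_add_distrib]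
    exact Finset.sum_congr rfl fun b _ => by ring
  rw [Finset.sum_congr rfl fun a _ => h1 a, Finset.sum_add_distrib, ← Finset.sum_mul, h0, zero_mul,
    add_zero]

lemma integrable_re_latticeChar_mul_stepSymbol (hφ₁ : 0 < φ₁) (hφ₂ : 0 < φ₂) (hφ₂' : φ₂ < 1)
    (i j : Fin 2) (h : ℤ × ℤ) :
    Integrable fun l : Plane => (latticeChar h l * stepSymbol i l *
      (starRingEnd ℂ) (stepSymbol j l)).re * specDensity φ₁ φ₂ l := by
  simp_rw [re_latticeChar_mul_stepSymbol]
  exact integrable_finsetSum _ fun a _ => integrable_finsetSum _ fun b _ =>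
    (integrable_one_sub_cos_mul_specDensity hφ₁ hφ₂ hφ₂' _).const_mul _

lemma integral_re_latticeChar_mul_stepSymbol (hφ₁ : 0 < φ₁) (hφ₂ : 0 < φ₂) (hφ₂' : φ₂ < 1)
    (i j : Fin 2) (h : ℤ × ℤ) :
    ∫ l : Plane, (latticeChar h l * stepSymbol i l *
      (starRingEnd ℂ) (stepSymbol j l)).re * specDensity φ₁ φ₂ l =
      (2 * Real.pi) ^ 2 * crossCov φ₁ φ₂ i j h := by
  have hi := fun a b => (integrable_one_sub_cos_mul_specDensity hφ₁ hφ₂ hφ₂'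
    (latticePoint (cornerLag i j h a b))).const_mul (-(cornerSign a * cornerSign b))
  simp_rw [re_latticeChar_mul_stepSymbol]
  rw [integral_finsetSum _ fun a _ => integrable_finsetSum _ fun b _ => hi a b, crossCov,
    Finset.mul_sum]
  refine Finset.sum_congr rfl fun a _ => ?_
  rw [integral_finsetSum _ fun b _ => hi a b, Finset.mul_sum]
  refine Finset.sum_congr rfl fun b _ => ?_
  rw [integral_const_mul, integral_one_sub_cos_mul_specDensity hφ₁ hφ₂ hφ₂']
  ring

/-- The modulus is dominated by the sum of the two diagonal cases at lag 0, where the product is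
real and already known to be integrable. -/
lemma integrable_latticeChar_mul_stepSymbol (hφ₁ : 0 < φ₁) (hφ₂ : 0 < φ₂) (hφ₂' : φ₂ < 1)
    (i j : Fin 2) (h : ℤ × ℤ) :
    Integrable fun l : Plane => latticeChar h l * stepSymbol i l *
      (starRingEnd ℂ) (stepSymbol j l) * (specDensity φ₁ φ₂ l : ℂ) := by
  have hd : ∀ k : Fin 2, Integrable fun l : Plane => ‖stepSymbol k l‖ ^ 2 * specDensity φ₁ φ₂ l := by
    intro k
    refine (integrable_re_latticeChar_mul_stepSymbol hφ₁ hφ₂ hφ₂' k k 0).congr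
      (ae_of_all _ fun l => ?_)
    simp only [latticeChar_zero, one_mul, Complex.mul_conj, Complex.ofReal_re,
      Complex.normSq_eq_norm_sq]
  refine ((hd i).add (hd j)).mono' (Measurable.aestronglyMeasurable (by fun_prop))
    (ae_of_all _ fun l => ?_)
  have h0 := specDensity_nonneg hφ₁ hφ₂ l
  simp only [norm_mul, norm_latticeChar, one_mul, RCLike.norm_conj, Complex.norm_real,
    Real.norm_of_nonneg h0, Pi.add_apply]
  rw [← add_mul]
  refine mul_le_mul_of_nonneg_right ?_ h0
  nlinarith [sq_nonneg (‖stepSymbol i l‖ - ‖stepSymbol j l‖), sq_nonneg ‖stepSymbol i l‖,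
    sq_nonneg ‖stepSymbol j l‖]

/-- The cross-spectral density of the bilinear differences. -/
noncomputable def crossSpec (φ₁ φ₂ : ℝ) (i j : Fin 2) (l : Plane) : ℂ :=
  stepSymbol i l * (starRingEnd ℂ) (stepSymbol j l) * (latticeSpec φ₁ φ₂ l : ℂ)

@[fun_prop]
lemma measurable_crossSpec (i j : Fin 2) : Measurable (crossSpec φ₁ φ₂ i j) := by
  unfold crossSpec
  fun_prop

lemma integral_torus_eq (f : Plane → ℂ) :
    ∫ l, f l ∂torusMeasure = ((1 / (2 * Real.pi) ^ 2 : ℝ) : ℂ) * ∫ l in torus, f l := by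
  rw [torusMeasure, integral_smul_measure, ENNReal.toReal_ofReal (by positivity),
    Complex.real_smul]

/-- The covariances are the Fourier coefficients of the cross-spectral density. -/
lemma crossCov_eq_integral (hφ₁ : 0 < φ₁) (hφ₂ : 0 < φ₂) (hφ₂' : φ₂ < 1)
    (i j : Fin 2) (h : ℤ × ℤ) :
    ((crossCov φ₁ φ₂ i j h : ℝ) : ℂ) =
      ∫ l, latticeChar h l * crossSpec φ₁ φ₂ i j l ∂torusMeasure := by
  set F : Plane → ℂ := fun l => latticeChar h l * stepSymbol i l *
      (starRingEnd ℂ) (stepSymbol j l) * (specDensity φ₁ φ₂ l : ℂ) with hF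
  have hi : Integrable F := integrable_latticeChar_mul_stepSymbol hφ₁ hφ₂ hφ₂' i j h
  have hm : Measurable F := by fun_prop
  -- Reflection `l ↦ -l` conjugates `F`, so the integral is real and its real part suffices.
  have hconj : ∫ l, F l = (starRingEnd ℂ) (∫ l, F l) := by
    rw [← integral_conj, ← integral_neg_eq_self F]
    refine integral_congr_ae (ae_of_all _ fun l => ?_)
    simp only [hF, latticeChar_neg_arg, stepSymbol_neg_arg, map_mul, Complex.conj_ofReal,
      specDensity, norm_neg]
  have hre : (∫ l, F l).re = (2 * Real.pi) ^ 2 * crossCov φ₁ φ₂ i j h := by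
    rw [← integral_re_latticeChar_mul_stepSymbol hφ₁ hφ₂ hφ₂']
    have := integral_re hi
    simp only [RCLike.re_eq_complex_re] at this
    rw [← this]
    refine integral_congr_ae (ae_of_all _ fun l => ?_)
    simp only [hF, Complex.re_mul_ofReal]
  have hFe : ∫ l, F l = (((2 * Real.pi) ^ 2 * crossCov φ₁ φ₂ i j h : ℝ) : ℂ) := by
    rw [← hre]; exact (Complex.conj_eq_iff_re.1 hconj.symm).symm
  have hu := integral_eq_integral_torus_tsum hm hi
  -- Characters and symbols are `2π`-periodic, so aliasing affects the density only.
  have hp : ∀ l, ∑' m : ℤ × ℤ, F (shiftFreq l m) = latticeChar h l * crossSpec φ₁ φ₂ i j l := by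
    intro l
    simp only [hF, latticeChar_shiftFreq, stepSymbol_shiftFreq]
    rw [tsum_mul_left, crossSpec, latticeSpec, Complex.ofReal_tsum]
    ring
  simp_rw [hp] at hu
  rw [integral_torus_eq, ← hu, hFe, ← Complex.ofReal_mul]
  congr 1
  field_simp

lemma norm_crossSpec_sq (hφ₁ : 0 < φ₁) (hφ₂ : 0 < φ₂) (i j : Fin 2) (l : Plane) :
    ‖crossSpec φ₁ φ₂ i j l‖ ^ 2 = bSymbol i l * bSymbol j l * diffSpec φ₁ φ₂ l ^ 2 := by
  have hi := norm_stepSymbol_sq_mul_latticeSpec φ₁ φ₂ i l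
  have hj := norm_stepSymbol_sq_mul_latticeSpec φ₁ φ₂ j l
  rw [crossSpec, norm_mul, norm_mul, RCLike.norm_conj, Complex.norm_real,
    Real.norm_of_nonneg (latticeSpec_nonneg hφ₁ hφ₂ l)]
  linear_combination (‖stepSymbol j l‖ ^ 2 * latticeSpec φ₁ φ₂ l) * hi +
    (bSymbol i l * diffSpec φ₁ φ₂ l) * hj

lemma exists_norm_crossSpec_le (hφ₁ : 0 < φ₁) (hφ₂ : 0 < φ₂) (hφ₂' : φ₂ < 1) :
    ∃ C, ∀ i j, ∀ l ∈ torus, ‖crossSpec φ₁ φ₂ i j l‖ ≤ C := by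
  obtain ⟨M, hM⟩ := exists_diffSpec_le hφ₁ hφ₂ hφ₂'
  refine ⟨16 * M, fun i j l hl => ?_⟩
  have h0 := diffSpec_nonneg hφ₁ hφ₂ l
  have h1 := hM l hl
  refine abs_le_of_sq_le_sq' ?_ (by linarith) |>.2
  rw [norm_crossSpec_sq hφ₁ hφ₂]
  calc bSymbol i l * bSymbol j l * diffSpec φ₁ φ₂ l ^ 2 ≤ 16 * 16 * M ^ 2 := by
        gcongr
        · exact bSymbol_nonneg j l
        · exact bSymbol_le i l
        · exact bSymbol_le j l
    _ = (16 * M) ^ 2 := by ring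

lemma hasSum_crossCov_sq (hφ₁ : 0 < φ₁) (hφ₂ : 0 < φ₂) (hφ₂' : φ₂ < 1) (i j : Fin 2) :
    HasSum (fun h => crossCov φ₁ φ₂ i j h ^ 2)
      (∫ l, bSymbol i l * bSymbol j l * diffSpec φ₁ φ₂ l ^ 2 ∂torusMeasure) := by
  obtain ⟨C, hC⟩ := exists_norm_crossSpec_le hφ₁ hφ₂ hφ₂'
  have h := hasSum_sq_norm_fourier (measurable_crossSpec (φ₁ := φ₁) (φ₂ := φ₂) i j) (hC i j)
  simp_rw [← crossCov_eq_integral hφ₁ hφ₂ hφ₂', norm_crossSpec_sq hφ₁ hφ₂, Complex.norm_real,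
    Real.norm_eq_abs, sq_abs] at h
  exact h

end

section

variable {φ₁ φ₂ : ℝ}

lemma ae_mem_torus : ∀ᵐ l ∂torusMeasure, l ∈ torus :=
  Measure.ae_smul_measure (ae_restrict_mem measurableSet_torus) _

lemma integrable_torusMeasure_of_bound {E : Type*} [NormedAddCommGroup E] {f : Plane → E}
    (hf : AEStronglyMeasurable f torusMeasure) {C : ℝ} (hC : ∀ l ∈ torus, ‖f l‖ ≤ C) :
    Integrable f torusMeasure :=
  Integrable.of_bound hf C (ae_mem_torus.mono hC)

/-! ### The covariance operator of the differenced field -/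

lemma crossCov_comm (i j : Fin 2) (h : ℤ × ℤ) :
    crossCov φ₁ φ₂ i j h = crossCov φ₁ φ₂ j i (-h) := by
  rw [crossCov, crossCov, Finset.sum_comm]
  refine Finset.sum_congr rfl fun a _ => Finset.sum_congr rfl fun b _ => ?_
  rw [mul_comm (cornerSign b)]
  congr 1
  have : latticePoint (cornerLag i j h b a) = -latticePoint (cornerLag j i (-h) a b) := by
    ext k
    fin_cases k <;> simp [latticePoint, cornerLag] <;> ring
  rw [this, genCov, genCov, norm_neg]

lemma integral_norm_sq_sum_latticeChar {ι : Type*} (s : Finset ι) (t : ι → ℤ × ℤ)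
    (ht : Set.InjOn t s) (c : ι → ℝ) :
    ∫ l, ‖∑ p ∈ s, (c p : ℂ) * latticeChar (t p) l‖ ^ 2 ∂torusMeasure = ∑ p ∈ s, c p ^ 2 := by
  have hpt : ∀ l, ((‖∑ p ∈ s, (c p : ℂ) * latticeChar (t p) l‖ ^ 2 : ℝ) : ℂ) =
      ∑ p ∈ s, ∑ q ∈ s, ((c p * c q : ℝ) : ℂ) * latticeChar (t p - t q) l := by
    intro l
    rw [← Complex.normSq_eq_norm_sq, ← Complex.mul_conj, map_sum, Finset.sum_mul_sum]
    refine Finset.sum_congr rfl fun p _ => Finset.sum_congr rfl fun q _ => ?_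
    rw [map_mul, Complex.conj_ofReal, conj_latticeChar, sub_eq_add_neg, latticeChar_add]
    push_cast
    ring
  have hint : ∀ p q, Integrable (fun l => ((c p * c q : ℝ) : ℂ) * latticeChar (t p - t q) l)
      torusMeasure := fun p q =>
    (integrable_torusMeasure_of_bound (Measurable.aestronglyMeasurable (by fun_prop)) (C := 1)
      fun l _ => (norm_latticeChar _ l).le).const_mul _
  rw [← Complex.ofReal_inj, ← integral_complex_ofReal]
  simp_rw [hpt]
  rw [integral_finsetSum _ fun p _ => integrable_finsetSum _ fun q _ => hint p q,
    Complex.ofReal_sum]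
  refine Finset.sum_congr rfl fun p hp => ?_
  rw [integral_finsetSum _ fun q _ => hint p q, Finset.sum_eq_single p]
  · rw [integral_const_mul, integral_latticeChar, if_pos (sub_self _)]
    push_cast; ring
  · intro q hq hqp
    rw [integral_const_mul, integral_latticeChar, if_neg, mul_zero]
    exact fun h => hqp (ht hq hp (sub_eq_zero.1 h).symm)
  · exact fun h => absurd hp h

/-- The spectral form of the covariance quadratic form: it yields positivity from `latticeSpec ≥ 0`,
and the operator bound from boundedness of the density. -/
lemma sum_crossCov_eq_integral (hφ₁ : 0 < φ₁) (hφ₂ : 0 < φ₂) (hφ₂' : φ₂ < 1) {ι : Type*}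
    [Fintype ι] (i : ι → Fin 2) (t : ι → ℤ × ℤ) (c : ι → ℝ) :
    ∑ p, ∑ q, c p * c q * crossCov φ₁ φ₂ (i p) (i q) (t p - t q) =
      ∫ l, ‖∑ p, (c p : ℂ) * latticeChar (t p) l * stepSymbol (i p) l‖ ^ 2 *
        latticeSpec φ₁ φ₂ l ∂torusMeasure := by
  obtain ⟨C, hC⟩ := exists_norm_crossSpec_le hφ₁ hφ₂ hφ₂'
  have hpt : ∀ l, ((‖∑ p, (c p : ℂ) * latticeChar (t p) l * stepSymbol (i p) l‖ ^ 2 *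
      latticeSpec φ₁ φ₂ l : ℝ) : ℂ) =
      ∑ p, ∑ q, ((c p * c q : ℝ) : ℂ) *
        (latticeChar (t p - t q) l * crossSpec φ₁ φ₂ (i p) (i q) l) := by
    intro l
    rw [Complex.ofReal_mul, ← Complex.normSq_eq_norm_sq, ← Complex.mul_conj, map_sum,
      Finset.sum_mul_sum, Finset.sum_mul]
    refine Finset.sum_congr rfl fun p _ => ?_
    rw [Finset.sum_mul]
    refine Finset.sum_congr rfl fun q _ => ?_
    rw [map_mul, map_mul, Complex.conj_ofReal, conj_latticeChar, sub_eq_add_neg, latticeChar_add,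
      crossSpec]
    push_cast
    ring
  have hint : ∀ p q, Integrable (fun l => ((c p * c q : ℝ) : ℂ) *
      (latticeChar (t p - t q) l * crossSpec φ₁ φ₂ (i p) (i q) l)) torusMeasure := fun p q =>
    (integrable_torusMeasure_of_bound (Measurable.aestronglyMeasurable (by fun_prop)) (C := C)
      fun l hl => by rw [norm_mul, norm_latticeChar, one_mul]; exact hC _ _ l hl).const_mul _
  rw [← Complex.ofReal_inj, ← integral_complex_ofReal]
  simp_rw [hpt]
  rw [integral_finsetSum _ fun p _ => integrable_finsetSum _ fun q _ => hint p q,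
    Complex.ofReal_sum]
  refine Finset.sum_congr rfl fun p hp => ?_
  rw [integral_finsetSum _ fun q _ => hint p q, Complex.ofReal_sum]
  refine Finset.sum_congr rfl fun q _ => ?_
  rw [integral_const_mul, ← crossCov_eq_integral hφ₁ hφ₂ hφ₂', Complex.ofReal_mul]

lemma sum_crossCov_nonneg (hφ₁ : 0 < φ₁) (hφ₂ : 0 < φ₂) (hφ₂' : φ₂ < 1) {ι : Type*}
    [Fintype ι] (i : ι → Fin 2) (t : ι → ℤ × ℤ) (c : ι → ℝ) :
    0 ≤ ∑ p, ∑ q, c p * c q * crossCov φ₁ φ₂ (i p) (i q) (t p - t q) := by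
  rw [sum_crossCov_eq_integral hφ₁ hφ₂ hφ₂']
  exact integral_nonneg fun l => mul_nonneg (sq_nonneg _) (latticeSpec_nonneg hφ₁ hφ₂ l)

/-- The covariance operator of the differenced field is bounded on `ℓ²`. -/
lemma exists_sum_crossCov_le (hφ₁ : 0 < φ₁) (hφ₂ : 0 < φ₂) (hφ₂' : φ₂ < 1) :
    ∃ κ : ℝ, 0 ≤ κ ∧ ∀ (ι : Type) [Fintype ι] (i : ι → Fin 2) (t : ι → ℤ × ℤ)
      (_ : Function.Injective fun p => (i p, t p)) (c : ι → ℝ),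
      ∑ p, ∑ q, c p * c q * crossCov φ₁ φ₂ (i p) (i q) (t p - t q) ≤ κ * ∑ p, c p ^ 2 := by
  classical
  obtain ⟨M, hM⟩ := exists_diffSpec_le hφ₁ hφ₂ hφ₂'
  have hM0 : 0 ≤ M := (diffSpec_nonneg hφ₁ hφ₂ 0).trans
    (hM 0 fun k => by simp [Real.pi_pos, Real.pi_pos.le])
  -- The factor 2 comes from `(x + y)² ≤ 2 (x² + y²)`, which separates the two steps, and 16 bounds
  -- `bSymbol`.
  refine ⟨32 * M, by positivity, fun ι _ i t hinj c => ?_⟩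
  -- The same lattice point may occur with both steps, so orthonormality of the characters is
  -- available only within one step.
  set s : Fin 2 → Finset ι := fun k => Finset.univ.filter fun p => i p = k with hs
  set W : Fin 2 → Plane → ℂ := fun k l => ∑ p ∈ s k, (c p : ℂ) * latticeChar (t p) l with hW
  have hWi : ∀ k, ∫ l, ‖W k l‖ ^ 2 ∂torusMeasure = ∑ p ∈ s k, c p ^ 2 := by
    intro k
    refine integral_norm_sq_sum_latticeChar (s k) t (fun p hp q hq hpq => hinj ?_) c
    simp only [hs, Finset.coe_filter, Finset.mem_univ, true_and, Set.mem_ofPred_eq] at hp hq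
    exact Prod.ext (hp.trans hq.symm) hpq
  have hWm : ∀ k, Measurable (W k) := fun k => by
    simp only [hW]
    fun_prop
  have hWint : ∀ k, Integrable (fun l => ‖W k l‖ ^ 2) torusMeasure := by
    intro k
    refine integrable_torusMeasure_of_bound (C := (∑ p ∈ s k, |c p|) ^ 2)
      (Measurable.aestronglyMeasurable (by fun_prop)) fun l _ => ?_
    rw [norm_pow, norm_norm]
    refine pow_le_pow_left₀ (norm_nonneg _) ((norm_sum_le _ _).trans_eq ?_) 2
    refine Finset.sum_congr rfl fun p _ => ?_
    rw [norm_mul, norm_latticeChar, mul_one, Complex.norm_real, Real.norm_eq_abs]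
  have hsum : ∀ l, ∑ p, (c p : ℂ) * latticeChar (t p) l * stepSymbol (i p) l =
      W 0 l * stepSymbol 0 l + W 1 l * stepSymbol 1 l := by
    intro l
    rw [← Finset.sum_fiberwise Finset.univ i, Fin.sum_univ_two]
    simp only [hW, hs, Finset.sum_mul]
    congr 1 <;>
      exact Finset.sum_congr rfl fun p hp => by rw [(Finset.mem_filter.1 hp).2]
  have htot : ∑ p, c p ^ 2 = ∑ p ∈ s 0, c p ^ 2 + ∑ p ∈ s 1, c p ^ 2 := by
    rw [← Finset.sum_fiberwise Finset.univ i, Fin.sum_univ_two]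
  rw [sum_crossCov_eq_integral hφ₁ hφ₂ hφ₂', htot, ← hWi, ← hWi, ← integral_add (hWint 0) (hWint 1),
    ← integral_const_mul]
  refine integral_mono_of_nonneg
    (ae_of_all _ fun l => mul_nonneg (sq_nonneg _) (latticeSpec_nonneg hφ₁ hφ₂ l))
    (((hWint 0).add (hWint 1)).const_mul _) (ae_mem_torus.mono fun l hl => ?_)
  simp only [hsum]
  have hb : ∀ k, ‖stepSymbol k l‖ ^ 2 * latticeSpec φ₁ φ₂ l ≤ 16 * M := fun k => by
    rw [norm_stepSymbol_sq_mul_latticeSpec]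
    exact mul_le_mul (bSymbol_le k l) (hM l hl) (diffSpec_nonneg hφ₁ hφ₂ l) (by norm_num)
  have hL := latticeSpec_nonneg hφ₁ hφ₂ l
  have hn : ‖W 0 l * stepSymbol 0 l + W 1 l * stepSymbol 1 l‖ ^ 2 ≤
      2 * (‖W 0 l‖ ^ 2 * ‖stepSymbol 0 l‖ ^ 2 + ‖W 1 l‖ ^ 2 * ‖stepSymbol 1 l‖ ^ 2) := by
    have h1 := norm_add_le (W 0 l * stepSymbol 0 l) (W 1 l * stepSymbol 1 l)
    rw [norm_mul, norm_mul] at h1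
    calc _ ≤ (‖W 0 l‖ * ‖stepSymbol 0 l‖ + ‖W 1 l‖ * ‖stepSymbol 1 l‖) ^ 2 := by gcongr
      _ ≤ _ := by
        nlinarith [sq_nonneg (‖W 0 l‖ * ‖stepSymbol 0 l‖ - ‖W 1 l‖ * ‖stepSymbol 1 l‖)]
  calc _ ≤ 2 * (‖W 0 l‖ ^ 2 * ‖stepSymbol 0 l‖ ^ 2 + ‖W 1 l‖ ^ 2 * ‖stepSymbol 1 l‖ ^ 2) *
        latticeSpec φ₁ φ₂ l := mul_le_mul_of_nonneg_right hn hL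
    _ = 2 * (‖W 0 l‖ ^ 2 * (‖stepSymbol 0 l‖ ^ 2 * latticeSpec φ₁ φ₂ l) +
        ‖W 1 l‖ ^ 2 * (‖stepSymbol 1 l‖ ^ 2 * latticeSpec φ₁ φ₂ l)) := by ring
    _ ≤ 2 * (‖W 0 l‖ ^ 2 * (16 * M) + ‖W 1 l‖ ^ 2 * (16 * M)) := by
        have h0 := mul_le_mul_of_nonneg_left (hb 0) (sq_nonneg ‖W 0 l‖)
        have h1 := mul_le_mul_of_nonneg_left (hb 1) (sq_nonneg ‖W 1 l‖)
        linarith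
    _ = _ := by ring

/-! ### The Gaussian law of the differenced field -/

variable {Ω : Type*} [MeasurableSpace Ω] {P : Measure Ω} {X : Plane → Ω → ℝ}

/-- Corners of different squares may coincide, whereas the field axioms take one coefficient per
point; weights are therefore collected over the fibres of `x`. -/
lemma IsPowerLawField.linearCombination (hX : IsPowerLawField P X φ₁ φ₂) {κ : Type*} [Fintype κ]
    (x : κ → Plane) (w : κ → ℝ) (hw : ∑ k, w k = 0) :
    HasGaussianLaw (fun ω => ∑ k, w k * X (x k) ω) P ∧
    ∫ ω, ∑ k, w k * X (x k) ω ∂P = 0 ∧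
    ProbabilityTheory.variance (fun ω => ∑ k, w k * X (x k) ω) P =
      ∑ k, ∑ m, w k * w m * genCov φ₁ φ₂ (x k - x m) := by
  classical
  set s : Finset Plane := Finset.univ.image x with hs
  set c : Plane → ℝ := fun y => ∑ k with x k = y, w k with hc
  have hmem : ∀ k ∈ Finset.univ, x k ∈ s := fun k hk => Finset.mem_image_of_mem _ hk
  have hgen : ∀ f : Plane → ℝ, ∑ y ∈ s, c y * f y = ∑ k, w k * f (x k) := by
    intro f
    rw [← Finset.sum_fiberwise_of_maps_to hmem]
    refine Finset.sum_congr rfl fun y _ => ?_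
    rw [hc, Finset.sum_mul]
    exact Finset.sum_congr rfl fun k hk => by rw [(Finset.mem_filter.1 hk).2]
  have hc0 : ∑ y ∈ s, c y = 0 := by simpa [hw] using hgen fun _ => 1
  have hfun : (fun ω => ∑ y ∈ s, c y * X y ω) = fun ω => ∑ k, w k * X (x k) ω :=
    funext fun ω => hgen fun y => X y ω
  refine ⟨hfun ▸ hX.gaussian s c hc0, ?_, ?_⟩
  · have := hX.mean_zero s c hc0
    rwa [hfun] at this
  · have := hX.variance s c hc0
    rw [hfun] at this
    rw [this]
    have h1 : ∀ y, ∑ z ∈ s, c y * c z * genCov φ₁ φ₂ (y - z) =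
        c y * ∑ m, w m * genCov φ₁ φ₂ (y - x m) := by
      intro y
      rw [← hgen fun z => genCov φ₁ φ₂ (y - z), Finset.mul_sum]
      exact Finset.sum_congr rfl fun z _ => by ring
    rw [Finset.sum_congr rfl fun y _ => h1 y, hgen fun y => ∑ m, w m * genCov φ₁ φ₂ (y - x m)]
    refine Finset.sum_congr rfl fun k _ => ?_
    rw [Finset.mul_sum]
    exact Finset.sum_congr rfl fun m _ => by ring

/-- A point of `ℕ²` as a point of `ℤ²`. -/
def intPoint (t : ℕ × ℕ) : ℤ × ℤ := (t.1, t.2)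

lemma intPoint_injective : Function.Injective intPoint := by
  intro s t h
  simp only [intPoint, Prod.mk.injEq, Nat.cast_inj] at h
  exact Prod.ext h.1 h.2

/-- The bilinear difference of step `i + 1` at `t` of the field `X`. -/
def increment (X : Plane → Ω → ℝ) (i : Fin 2) (t : ℕ × ℕ) (ω : Ω) : ℝ :=
  bilinDiff (i.val + 1) (sample fun x => X x ω) t

lemma IsPowerLawField.increment_combination (hX : IsPowerLawField P X φ₁ φ₂) {ι : Type*}
    [Fintype ι] (i : ι → Fin 2) (t : ι → ℕ × ℕ) (c : ι → ℝ) :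
    HasGaussianLaw (fun ω => ∑ p, c p * increment X (i p) (t p) ω) P ∧
    ∫ ω, ∑ p, c p * increment X (i p) (t p) ω ∂P = 0 ∧
    ProbabilityTheory.variance (fun ω => ∑ p, c p * increment X (i p) (t p) ω) P =
      ∑ p, ∑ q, c p * c q *
        crossCov φ₁ φ₂ (i p) (i q) (intPoint (t p) - intPoint (t q)) := by
  set x : ι × (Fin 2 × Fin 2) → Plane := fun k =>
    !₂[(((t k.1).1 + ((i k.1).val + 1) * k.2.1.val : ℕ) : ℝ),
      (((t k.1).2 + ((i k.1).val + 1) * k.2.2.val : ℕ) : ℝ)] with hx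
  set w : ι × (Fin 2 × Fin 2) → ℝ := fun k => c k.1 * cornerSign k.2 with hw
  have hw0 : ∑ k, w k = 0 := by
    rw [Fintype.sum_prod_type]
    simp only [hw, ← Finset.mul_sum, sum_cornerSign, mul_zero, Finset.sum_const_zero]
  obtain ⟨h1, h2, h3⟩ := hX.linearCombination x w hw0
  have hfun : (fun ω => ∑ k, w k * X (x k) ω) =
      fun ω => ∑ p, c p * increment X (i p) (t p) ω := by
    funext ω
    rw [Fintype.sum_prod_type]
    refine Finset.sum_congr rfl fun p _ => ?_
    rw [increment, bilinDiff_eq_sum, Finset.mul_sum]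
    refine Finset.sum_congr rfl fun a _ => ?_
    simp only [hw, hx, sample]
    ring
  rw [hfun] at h1 h2 h3
  refine ⟨h1, h2, h3.trans ?_⟩
  rw [Fintype.sum_prod_type]
  refine Finset.sum_congr rfl fun p _ => ?_
  rw [Finset.sum_comm, Fintype.sum_prod_type]
  refine Finset.sum_congr rfl fun q _ => ?_
  rw [Finset.sum_comm, crossCov, Finset.mul_sum]
  refine Finset.sum_congr rfl fun a _ => ?_
  rw [Finset.mul_sum]
  refine Finset.sum_congr rfl fun b _ => ?_
  have : x (p, a) - x (q, b) =
      latticePoint (cornerLag (i p) (i q) (intPoint (t p) - intPoint (t q)) a b) := by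
    ext k
    fin_cases k <;> simp [hx, latticePoint, cornerLag, intPoint] <;> ring
  rw [this]
  simp only [hw]
  ring

lemma IsPowerLawField.aemeasurable_increment (hX : IsPowerLawField P X φ₁ φ₂) (i : Fin 2)
    (t : ℕ × ℕ) : AEMeasurable (increment X i t) P := by
  have h := hX.aemeasurable
  unfold increment bilinDiff sample
  fun_prop

/-- The covariance matrix of a finite family of increments. -/
noncomputable def incrementCov (φ₁ φ₂ : ℝ) {ι : Type*} (i : ι → Fin 2) (t : ι → ℕ × ℕ) :
    Matrix ι ι ℝ :=
  Matrix.of fun p q => crossCov φ₁ φ₂ (i p) (i q) (intPoint (t p) - intPoint (t q))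

lemma dotProduct_incrementCov {ι : Type*} [Fintype ι] (i : ι → Fin 2) (t : ι → ℕ × ℕ)
    (c : ι → ℝ) :
    c ⬝ᵥ (incrementCov φ₁ φ₂ i t).mulVec c =
      ∑ p, ∑ q, c p * c q * crossCov φ₁ φ₂ (i p) (i q) (intPoint (t p) - intPoint (t q)) := by
  simp only [dotProduct, Matrix.mulVec, incrementCov, Matrix.of_apply, Finset.mul_sum]
  exact Finset.sum_congr rfl fun p _ => Finset.sum_congr rfl fun q _ => by ring

lemma posSemidef_incrementCov (hφ₁ : 0 < φ₁) (hφ₂ : 0 < φ₂) (hφ₂' : φ₂ < 1) {ι : Type*}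
    [Fintype ι] (i : ι → Fin 2) (t : ι → ℕ × ℕ) : (incrementCov φ₁ φ₂ i t).PosSemidef := by
  refine Matrix.PosSemidef.of_dotProduct_mulVec_nonneg ?_ fun c => ?_
  · ext p q
    simp only [incrementCov, Matrix.conjTranspose_apply, Matrix.of_apply, star_trivial]
    rw [crossCov_comm, neg_sub]
  · rw [star_trivial, dotProduct_incrementCov]
    exact sum_crossCov_nonneg hφ₁ hφ₂ hφ₂' i _ c

/-- Cramér–Wold: the characteristic function of the vector at `c` is that of the Gaussian variable
`∑ c p * increment` at 1. -/
lemma IsPowerLawField.map_increment (hX : IsPowerLawField P X φ₁ φ₂) [IsProbabilityMeasure P]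
    (hφ₁ : 0 < φ₁) (hφ₂ : 0 < φ₂) (hφ₂' : φ₂ < 1) {ι : Type*} [Fintype ι] [DecidableEq ι]
    (i : ι → Fin 2) (t : ι → ℕ × ℕ) :
    P.map (fun ω => (WithLp.toLp 2 fun p => increment X (i p) (t p) ω : EuclideanSpace ℝ ι)) =
      multivariateGaussian 0 (incrementCov φ₁ φ₂ i t) := by
  have hm : AEMeasurable
      (fun ω => (WithLp.toLp 2 fun p => increment X (i p) (t p) ω : EuclideanSpace ℝ ι)) P :=
    (WithLp.measurable_toLp 2 _).comp_aemeasurable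
      (aemeasurable_pi_lambda _ fun p => hX.aemeasurable_increment (i p) (t p))
  have := Measure.isProbabilityMeasure_map hm
  refine Measure.ext_of_charFun (funext fun c => ?_)
  rw [charFun_multivariateGaussian (posSemidef_incrementCov hφ₁ hφ₂ hφ₂' i t), charFun_apply,
    integral_map hm (by fun_prop)]
  obtain ⟨h1, h2, h3⟩ := hX.increment_combination i t c.ofLp
  have h4 := h1.charFun_map_eq 1
  rw [charFun_apply_real, integral_map h1.aemeasurable (by fun_prop)] at h4
  have h5 : ∀ ω, inner ℝ (WithLp.toLp 2 fun p => increment X (i p) (t p) ω : EuclideanSpace ℝ ι) c =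
      ∑ p, c p * increment X (i p) (t p) ω := by
    intro ω
    simp [PiLp.inner_apply]
  simp_rw [h5]
  simp only [Complex.ofReal_one, one_mul] at h4
  rw [h4]
  have h6 : P[fun ω => inner ℝ (1 : ℝ) (∑ p, c p * increment X (i p) (t p) ω)] = 0 := by
    simpa using h2
  have h7 : ProbabilityTheory.variance (fun ω => inner ℝ (1 : ℝ) (∑ p, c p * increment X (i p) (t p) ω)) P =
      ∑ p, ∑ q, c p * c q *
        crossCov φ₁ φ₂ (i p) (i q) (intPoint (t p) - intPoint (t q)) := by
    simpa using h3
  rw [h6, h7, dotProduct_incrementCov]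
  simp

end

/-! ### Sums over pairs of grid points -/

lemma card_grid (k : ℕ) : (grid k).card = k ^ 2 := by
  simp [grid, sq]

/-- The number of pairs of points of two grids at lag `h`. -/
def lagCount (a b : ℕ) (h : ℤ × ℤ) : ℕ :=
  {p ∈ grid a ×ˢ grid b | intPoint p.1 - intPoint p.2 = h}.card

/-- Grouping pairs by lag gives a series over a fixed index set, ready for dominated convergence. -/
lemma sum_grid_eq_tsum (a b : ℕ) (g : ℤ × ℤ → ℝ) :
    ∑ t ∈ grid a, ∑ u ∈ grid b, g (intPoint t - intPoint u) = ∑' h, (lagCount a b h : ℝ) * g h := by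
  rw [← Finset.sum_product', Finset.sum_comp g
    (fun p : (ℕ × ℕ) × (ℕ × ℕ) => intPoint p.1 - intPoint p.2), tsum_eq_sum]
  · exact Finset.sum_congr rfl fun h _ => nsmul_eq_mul _ _
  · intro h hh
    have : lagCount a b h = 0 := by
      refine Finset.card_eq_zero.2 (Finset.filter_eq_empty_iff.2 fun p hp heq => hh ?_)
      exact Finset.mem_image.2 ⟨p, hp, heq⟩
    rw [this, Nat.cast_zero, zero_mul]

lemma lagCount_le (a b : ℕ) (h : ℤ × ℤ) : lagCount a b h ≤ a ^ 2 := by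
  rw [← card_grid a]
  refine Finset.card_le_card_of_injOn Prod.fst
    (fun p hp => (Finset.mem_product.1 (Finset.mem_filter.1 hp).1).1) fun p hp q hq hpq => ?_
  have h1 := (Finset.mem_filter.1 hp).2
  have h2 := (Finset.mem_filter.1 hq).2
  refine Prod.ext hpq (intPoint_injective ?_)
  rw [hpq, ← h2] at h1
  simpa using h1

lemma le_lagCount (n c d : ℕ) (h : ℤ × ℤ) :
    (n - (c + d + h.1.natAbs)) * (n - (c + d + h.2.natAbs)) ≤ lagCount (n - c) (n - d) h := by
  -- For `t` in this box, `t` lies in the first grid and `t - h` in the second. Removing `c + d`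
  -- from both is wasteful but harmless in the limit; with truncated subtraction the bound becomes 0
  -- for large lags.
  set s : Finset (ℕ × ℕ) := Finset.Ico h.1.toNat (n - c - d - (-h.1).toNat) ×ˢ
    Finset.Ico h.2.toNat (n - c - d - (-h.2).toNat) with hs
  have hcard : (n - (c + d + h.1.natAbs)) * (n - (c + d + h.2.natAbs)) = s.card := by
    rw [hs, Finset.card_product, Nat.card_Ico, Nat.card_Ico]
    congr 1 <;> omega
  rw [hcard]
  refine Finset.card_le_card_of_injOn
    (fun t => (t, ((t.1 - h.1 : ℤ).toNat, (t.2 - h.2 : ℤ).toNat))) (fun t ht => ?_)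
    (fun t _ u _ htu => (Prod.ext_iff.1 htu).1)
  simp only [hs, Finset.coe_product, Set.mem_prod, Finset.coe_Ico, Set.mem_Ico] at ht
  simp only [Finset.coe_filter, Finset.mem_product, grid, Finset.mem_range, Set.mem_ofPred_eq,
    intPoint, Prod.ext_iff, Prod.fst_sub, Prod.snd_sub]
  omega

lemma tendsto_natSub_div (k : ℕ) :
    Tendsto (fun n : ℕ => ((n - k : ℕ) : ℝ) / n) atTop (𝓝 1) := by
  have h : Tendsto (fun n : ℕ => 1 - (k : ℝ) / n) atTop (𝓝 (1 - 0)) :=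
    tendsto_const_nhds.sub (tendsto_const_div_atTop_nhds_zero_nat _)
  rw [sub_zero] at h
  refine h.congr' ?_
  filter_upwards [eventually_ge_atTop (k + 1)] with n hn
  have : (n : ℝ) ≠ 0 := by
    have : 0 < n := by omega
    positivity
  rw [Nat.cast_sub (by omega)]
  field_simp

lemma tendsto_lagCount_div (c d : ℕ) (h : ℤ × ℤ) :
    Tendsto (fun n : ℕ => (lagCount (n - c) (n - d) h : ℝ) / n ^ 2) atTop (𝓝 1) := by
  have h1 := (tendsto_natSub_div (c + d + h.1.natAbs)).mul
    (tendsto_natSub_div (c + d + h.2.natAbs))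
  rw [one_mul] at h1
  refine tendsto_of_tendsto_of_tendsto_of_le_of_le h1 tendsto_const_nhds (fun n => ?_) fun n => ?_
  · simp only
    rw [div_mul_div_comm, ← sq]
    refine div_le_div_of_nonneg_right ?_ (by positivity)
    exact_mod_cast le_lagCount n c d h
  · refine (div_le_one_of_le₀ ?_ (by positivity) :
      (lagCount (n - c) (n - d) h : ℝ) / (n : ℝ) ^ 2 ≤ 1)
    have := (lagCount_le (n - c) (n - d) h).trans (Nat.pow_le_pow_left (Nat.sub_le n c) 2)
    exact_mod_cast this

/-- Each lag has weight `lagCount / n²`, which is at most 1 and tends to 1, so `g` itself dominates.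
-/
lemma tendsto_sum_grid_div (c d : ℕ) {g : ℤ × ℤ → ℝ} (hg : ∀ h, 0 ≤ g h) (hs : Summable g) :
    Tendsto (fun n : ℕ => (∑ t ∈ grid (n - c), ∑ u ∈ grid (n - d),
      g (intPoint t - intPoint u)) / n ^ 2) atTop (𝓝 (∑' h, g h)) := by
  have h1 : ∀ n : ℕ, (∑ t ∈ grid (n - c), ∑ u ∈ grid (n - d),
      g (intPoint t - intPoint u)) / n ^ 2 =
      ∑' h, (lagCount (n - c) (n - d) h : ℝ) / n ^ 2 * g h := by
    intro n
    rw [sum_grid_eq_tsum, ← tsum_div_const]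
    exact tsum_congr fun h => by ring
  simp_rw [h1]
  refine tendsto_tsum_of_dominated_convergence hs (fun h => ?_) (Eventually.of_forall fun n h => ?_)
  · simpa using (tendsto_lagCount_div c d h).mul_const (g h)
  · rw [norm_mul, Real.norm_of_nonneg (by positivity), Real.norm_of_nonneg (hg h)]
    refine mul_le_of_le_one_left (hg h) (div_le_one_of_le₀ ?_ (by positivity))
    have := (lagCount_le (n - c) (n - d) h).trans (Nat.pow_le_pow_left (Nat.sub_le n c) 2)
    exact_mod_cast this

lemma tendsto_sq_div_card_grid (c : ℕ) :
    Tendsto (fun n : ℕ => (n : ℝ) ^ 2 / ((grid (n - c)).card : ℝ)) atTop (𝓝 1) := by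
  have h := ((tendsto_natSub_div c).pow 2).inv₀ (by norm_num)
  simp only [one_pow, inv_one] at h
  refine h.congr fun n => ?_
  rw [card_grid, div_pow, inv_div]
  push_cast
  rfl

/-! ### The central limit theorem for the quadratic variations -/

section

variable {φ₁ φ₂ : ℝ} {Ω : Type*} [MeasurableSpace Ω] {P : Measure Ω} {X : Plane → Ω → ℝ}

lemma IsPowerLawField.integral_increment_sq (hX : IsPowerLawField P X φ₁ φ₂) (i : Fin 2)
    (t : ℕ × ℕ) :
    Integrable (fun ω => increment X i t ω ^ 2) P ∧
      ∫ ω, increment X i t ω ^ 2 ∂P = crossCov φ₁ φ₂ i i 0 := by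
  obtain ⟨h1, h2, h3⟩ := hX.increment_combination (ι := Unit) (fun _ => i) (fun _ => t) fun _ => 1
  simp only [Finset.univ_unique, Finset.sum_singleton, one_mul, sub_self] at h1 h2 h3
  refine ⟨h1.memLp_two.integrable_sq, ?_⟩
  rwa [variance_of_integral_eq_zero h1.aemeasurable h2] at h3

lemma IsPowerLawField.integral_quadVar (hX : IsPowerLawField P X φ₁ φ₂) (i : Fin 2) {n : ℕ}
    (hn : 2 * (i.val + 1) < n) :
    Integrable (fun ω => quadVar (i.val + 1) n (sample fun x => X x ω)) P ∧
      ∫ ω, quadVar (i.val + 1) n (sample fun x => X x ω) ∂P = crossCov φ₁ φ₂ i i 0 := by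
  have h := hX.integral_increment_sq i
  refine ⟨(integrable_finsetSum _ fun t _ => (h t).1).div_const _, ?_⟩
  simp only [quadVar]
  rw [integral_div]
  have hsum : ∫ ω, ∑ t ∈ grid (n - 2 * (i.val + 1)), bilinDiff (i.val + 1)
      (sample fun x => X x ω) t ^ 2 ∂P =
      (grid (n - 2 * (i.val + 1))).card * crossCov φ₁ φ₂ i i 0 := by
    refine (integral_finsetSum _ fun t _ => (h t).1).trans ?_
    rw [Finset.sum_congr rfl fun t _ => (h t).2,
      Finset.sum_const, nsmul_eq_mul]
  have : ((grid (n - 2 * (i.val + 1))).card : ℝ) ≠ 0 := by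
    rw [card_grid]
    have : 0 < n - 2 * (i.val + 1) := by omega
    positivity
  rw [hsum, mul_div_cancel_left₀ _ this]

/-- The expectations of the quadratic variations. -/
noncomputable def quadMean (φ₁ φ₂ : ℝ) : Plane := WithLp.toLp 2 fun i => crossCov φ₁ φ₂ i i 0

/-- The pair of quadratic variations of a realization. -/
noncomputable def quadVarVec (X : Plane → Ω → ℝ) (n : ℕ) (ω : Ω) : Plane :=
  WithLp.toLp 2 fun i => quadVar (i.val + 1) n (sample fun x => X x ω)

lemma IsPowerLawField.aemeasurable_quadVarVec (hX : IsPowerLawField P X φ₁ φ₂) (n : ℕ) :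
    AEMeasurable (quadVarVec X n) P := by
  refine (WithLp.measurable_toLp 2 _).comp_aemeasurable (aemeasurable_pi_lambda _ fun i => ?_)
  have h := fun t => hX.aemeasurable_increment i t
  exact (Finset.aemeasurable_fun_sum _ fun t _ => (h t).pow_const 2).div_const _

lemma IsPowerLawField.aemeasurable_standardized (hX : IsPowerLawField P X φ₁ φ₂) (n : ℕ) :
    AEMeasurable (fun ω => √((n ^ 2 : ℕ) : ℝ) • (quadVarVec X n ω - quadMean φ₁ φ₂)) P := by
  have h := hX.aemeasurable_quadVarVec n
  fun_prop

/-- The steps and positions of the increments that enter the quadratic variations. -/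
def obs (n : ℕ) : Finset (Σ _ : Fin 2, ℕ × ℕ) :=
  Finset.univ.sigma fun i => grid (n - 2 * (i.val + 1))

lemma sum_obs (n : ℕ) (f : Fin 2 → ℕ × ℕ → ℝ) :
    ∑ p : obs n, f p.1.1 p.1.2 = ∑ i, ∑ t ∈ grid (n - 2 * (i.val + 1)), f i t := by
  rw [Finset.sum_coe_sort (obs n) fun p => f p.1 p.2, obs, Finset.sum_sigma]

/-- The coefficient of an increment of step `i + 1` in the standardized quadratic variation in the
direction `θ`. -/
noncomputable def obsCoeff (θ : Plane) (n : ℕ) (i : Fin 2) : ℝ :=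
  θ i * (n / ((grid (n - 2 * (i.val + 1))).card : ℝ))

/-- The variance parameter of the standardized quadratic variation in the direction `θ`. -/
noncomputable def obsVar (φ₁ φ₂ : ℝ) (θ : Plane) (n : ℕ) : ℝ :=
  ∑ p : obs n, ∑ q : obs n, obsCoeff θ n p.1.1 * obsCoeff θ n q.1.1 *
    incrementCov φ₁ φ₂ (fun p : obs n => p.1.1) (fun p => p.1.2) p q ^ 2

/-- The factor `1 / 2` appears because the variance of the Gaussian quadratic form is `2 ∑ aₚ a_q
Γₚ_q²`, and `SigmaQ` includes that 2. -/
lemma tendsto_obsVar (hφ₁ : 0 < φ₁) (hφ₂ : 0 < φ₂) (hφ₂' : φ₂ < 1) (θ : Plane) :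
    Tendsto (obsVar φ₁ φ₂ θ) atTop
      (𝓝 (∑ i, ∑ j, θ i * θ j * (1 / 2 * SigmaQ φ₁ φ₂ i j))) := by
  have h1 : ∀ n : ℕ, obsVar φ₁ φ₂ θ n = ∑ i : Fin 2, ∑ j : Fin 2, θ i * θ j *
      ((n : ℝ) ^ 2 / ((grid (n - 2 * (i.val + 1))).card : ℝ) *
        ((n : ℝ) ^ 2 / ((grid (n - 2 * (j.val + 1))).card : ℝ)) *
        ((∑ t ∈ grid (n - 2 * (i.val + 1)), ∑ u ∈ grid (n - 2 * (j.val + 1)),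
          crossCov φ₁ φ₂ i j (intPoint t - intPoint u) ^ 2) / n ^ 2)) := by
    intro n
    simp only [obsVar, incrementCov, Matrix.of_apply]
    rw [sum_obs n fun i t => ∑ q : obs n, obsCoeff θ n i * obsCoeff θ n q.1.1 *
      crossCov φ₁ φ₂ i q.1.1 (intPoint t - intPoint q.1.2) ^ 2]
    refine Finset.sum_congr rfl fun i _ => ?_
    have h2 : ∀ t : ℕ × ℕ, ∑ q : obs n, obsCoeff θ n i * obsCoeff θ n q.1.1 *
        crossCov φ₁ φ₂ i q.1.1 (intPoint t - intPoint q.1.2) ^ 2 =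
        ∑ j : Fin 2, ∑ u ∈ grid (n - 2 * (j.val + 1)), obsCoeff θ n i * obsCoeff θ n j *
          crossCov φ₁ φ₂ i j (intPoint t - intPoint u) ^ 2 := fun t =>
      sum_obs n fun j u => obsCoeff θ n i * obsCoeff θ n j *
        crossCov φ₁ φ₂ i j (intPoint t - intPoint u) ^ 2
    rw [Finset.sum_congr rfl fun t _ => h2 t, Finset.sum_comm]
    refine Finset.sum_congr rfl fun j _ => ?_
    simp_rw [← Finset.mul_sum]
    rcases Nat.eq_zero_or_pos n with rfl | hn
    · simp [obsCoeff]
    have hn' : (n : ℝ) ≠ 0 := by positivity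
    rw [obsCoeff, obsCoeff]
    field_simp
  have h3 : ∀ i j : Fin 2, Tendsto (fun n : ℕ =>
      ((n : ℝ) ^ 2 / ((grid (n - 2 * (i.val + 1))).card : ℝ) *
        ((n : ℝ) ^ 2 / ((grid (n - 2 * (j.val + 1))).card : ℝ)) *
        ((∑ t ∈ grid (n - 2 * (i.val + 1)), ∑ u ∈ grid (n - 2 * (j.val + 1)),
          crossCov φ₁ φ₂ i j (intPoint t - intPoint u) ^ 2) / (n : ℝ) ^ 2))) atTop
      (𝓝 (1 / 2 * SigmaQ φ₁ φ₂ i j)) := by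
    intro i j
    have hs := hasSum_crossCov_sq hφ₁ hφ₂ hφ₂' i j
    have h4 := tendsto_sum_grid_div (2 * (i.val + 1)) (2 * (j.val + 1))
      (g := fun h => crossCov φ₁ φ₂ i j h ^ 2) (fun _ => sq_nonneg _) hs.summable
    have h5 := ((tendsto_sq_div_card_grid (2 * (i.val + 1))).mul
      (tendsto_sq_div_card_grid (2 * (j.val + 1)))).mul h4
    rw [hs.tsum_eq] at h5
    convert h5 using 2
    simp [SigmaQ]
  rw [funext h1]
  exact tendsto_finsetSum _ fun i _ => tendsto_finsetSum _ fun j _ => (h3 i j).const_mul _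

lemma tendsto_charFun_quadVarVec (hX : IsPowerLawField P X φ₁ φ₂) [IsProbabilityMeasure P]
    (hφ₁ : 0 < φ₁) (hφ₂ : 0 < φ₂) (hφ₂' : φ₂ < 1) (θ : Plane) :
    Tendsto (fun n : ℕ => charFun
        (P.map fun ω => √((n ^ 2 : ℕ) : ℝ) • (quadVarVec X n ω - quadMean φ₁ φ₂)) θ) atTop
      (𝓝 (Complex.exp (-((∑ i, ∑ j, θ i * θ j * (1 / 2 * SigmaQ φ₁ φ₂ i j) : ℝ) : ℂ)))) := by
  set T := ∑ i, ∑ j, θ i * θ j * (1 / 2 * SigmaQ φ₁ φ₂ i j) with hT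
  have hTn := tendsto_obsVar hφ₁ hφ₂ hφ₂' θ
  obtain ⟨κ, hκ0, hκ⟩ := exists_sum_crossCov_le hφ₁ hφ₂ hφ₂'
  -- the characteristic function is that of a quadratic form
  have hchar : ∀ n : ℕ, 4 < n → charFun
      (P.map fun ω => √((n ^ 2 : ℕ) : ℝ) • (quadVarVec X n ω - quadMean φ₁ φ₂)) θ =
      ∫ y : EuclideanSpace ℝ (obs n), Complex.exp (Complex.I * ((∑ p : obs n,
        obsCoeff θ n p.1.1 * (y p ^ 2 -
          incrementCov φ₁ φ₂ (fun p : obs n => p.1.1) (fun p => p.1.2) p p) : ℝ) : ℂ))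
        ∂(multivariateGaussian 0
          (incrementCov φ₁ φ₂ (fun p : obs n => p.1.1) (fun p => p.1.2))) := by
    -- Beyond 4 both grids are nonempty, so the averages have nonzero denominators.
    intro n hn
    have hm : AEMeasurable
        (fun ω => √((n ^ 2 : ℕ) : ℝ) • (quadVarVec X n ω - quadMean φ₁ φ₂)) P :=
      hX.aemeasurable_standardized n
    have hm2 : AEMeasurable (fun ω => (WithLp.toLp 2 fun p : obs n => increment X p.1.1 p.1.2 ω :
        EuclideanSpace ℝ (obs n))) P :=
      (WithLp.measurable_toLp 2 _).comp_aemeasurable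
        (aemeasurable_pi_lambda _ fun p => hX.aemeasurable_increment _ _)
    rw [charFun_apply, integral_map hm (by fun_prop),
      ← hX.map_increment hφ₁ hφ₂ hφ₂', integral_map hm2 (by fun_prop)]
    refine integral_congr_ae (ae_of_all _ fun ω => ?_)
    simp only
    rw [mul_comm]
    congr 3
    have hsq : √((n ^ 2 : ℕ) : ℝ) = n := by
      push_cast
      exact Real.sqrt_sq (by positivity)
    simp only [incrementCov, Matrix.of_apply, sub_self]
    rw [sum_obs n fun i t => obsCoeff θ n i * (increment X i t ω ^ 2 - crossCov φ₁ φ₂ i i 0), hsq,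
      PiLp.inner_apply]
    refine Finset.sum_congr rfl fun i _ => ?_
    have hc : ((grid (n - 2 * (i.val + 1))).card : ℝ) ≠ 0 := by
      rw [card_grid]
      have : 0 < n - 2 * (i.val + 1) := by omega
      positivity
    simp only [PiLp.smul_apply, PiLp.sub_apply, quadVarVec, quadMean, smul_eq_mul,
      RCLike.inner_apply, conj_trivial]
    rw [← Finset.mul_sum, Finset.sum_sub_distrib, Finset.sum_const, nsmul_eq_mul, obsCoeff,
      quadVar]
    simp only [increment]
    field_simp
  -- the coefficients tend to zero
  have hsmall : Tendsto (fun n : ℕ => ‖θ‖ * ((n : ℝ) / ((grid (n - 4)).card : ℝ)) * κ) atTop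
      (𝓝 0) := by
    have h1 := (tendsto_sq_div_card_grid 4).mul (tendsto_one_div_atTop_nhds_zero_nat (𝕜 := ℝ))
    have h2 : Tendsto (fun n : ℕ => (n : ℝ) / ((grid (n - 4)).card : ℝ)) atTop (𝓝 0) := by
      rw [mul_zero] at h1
      refine h1.congr fun n => ?_
      rcases Nat.eq_zero_or_pos n with rfl | hn
      · simp
      have hn' : (n : ℝ) ≠ 0 := by positivity
      field_simp
    simpa using (h2.const_mul ‖θ‖).mul_const κ
  have hdiff : Tendsto (fun n : ℕ => charFun
      (P.map fun ω => √((n ^ 2 : ℕ) : ℝ) • (quadVarVec X n ω - quadMean φ₁ φ₂)) θ -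
      Complex.exp (-((obsVar φ₁ φ₂ θ n : ℝ) : ℂ))) atTop (𝓝 0) := by
    rw [Metric.tendsto_atTop']
    intro ε hε
    -- Eventually `obsVar < |T| + 1`, so the error is at most `ε / 2`.
    set ε' := ε / (2 * (|T| + 1)) with hε'
    have hε'0 : 0 < ε' := by positivity
    obtain ⟨δ, hδ, H⟩ := charFun_quadForm_approx hε'0
    have e1 := hsmall.eventually (gt_mem_nhds hδ)
    have e2 := hTn.eventually (gt_mem_nhds (show T < |T| + 1 by linarith [le_abs_self T]))
    obtain ⟨n0, hn0⟩ := eventually_atTop.1 (e1.and (e2.and (eventually_gt_atTop 4)))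
    refine ⟨n0, fun n hn => ?_⟩
    obtain ⟨f1, f2, f3⟩ := hn0 n hn.le
    have hcoef : ∀ p : obs n, |obsCoeff θ n p.1.1| ≤
        ‖θ‖ * ((n : ℝ) / ((grid (n - 4)).card : ℝ)) := by
      intro p
      rw [obsCoeff, abs_mul, abs_of_nonneg (a := (n : ℝ) / _) (by positivity)]
      have hc : (0 : ℝ) < ((grid (n - 4)).card : ℝ) := by
        rw [card_grid]
        have : 0 < n - 4 := by omega
        positivity
      have hle : ((grid (n - 4)).card : ℝ) ≤ ((grid (n - 2 * (p.1.1.val + 1))).card : ℝ) := by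
        rw [card_grid, card_grid]
        have : n - 4 ≤ n - 2 * (p.1.1.val + 1) := by omega
        exact_mod_cast Nat.pow_le_pow_left this 2
      exact mul_le_mul (PiLp.norm_apply_le θ _) (by gcongr) (by positivity) (norm_nonneg _)
    have hop : ∀ c : obs n → ℝ, c ⬝ᵥ
        (incrementCov φ₁ φ₂ (fun p : obs n => p.1.1) (fun p => p.1.2)).mulVec c ≤
        κ * (c ⬝ᵥ c) := by
      intro c
      rw [dotProduct_incrementCov]
      refine (hκ (obs n) (fun p => p.1.1) (fun p => intPoint p.1.2) ?_ c).trans_eq ?_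
      · intro p q hpq
        simp only [Prod.mk.injEq] at hpq
        exact Subtype.ext (Sigma.ext hpq.1 (heq_of_eq (intPoint_injective hpq.2)))
      · simp only [dotProduct, sq]
    have hH := H (obs n) _ (posSemidef_incrementCov hφ₁ hφ₂ hφ₂' (fun p : obs n => p.1.1)
      (fun p => p.1.2)) (fun p => obsCoeff θ n p.1.1) _ κ hcoef hop f1.le
    rw [← hchar n f3] at hH
    rw [dist_zero_right]
    refine hH.trans_lt ?_
    calc ε' * obsVar φ₁ φ₂ θ n ≤ ε' * (|T| + 1) := by gcongr
      _ = ε / 2 := by rw [hε']; field_simp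
      _ < ε := by linarith
  have hexp : Tendsto (fun n : ℕ => Complex.exp (-((obsVar φ₁ φ₂ θ n : ℝ) : ℂ))) atTop
      (𝓝 (Complex.exp (-((T : ℝ) : ℂ)))) :=
    (Complex.continuous_exp.tendsto _).comp
      ((Complex.continuous_ofReal.tendsto _).comp hTn).neg
  simpa using hdiff.add hexp

lemma integrable_bSymbol_mul_diffSpec_sq (hφ₁ : 0 < φ₁) (hφ₂ : 0 < φ₂) (hφ₂' : φ₂ < 1)
    (i j : Fin 2) :
    Integrable (fun l => bSymbol i l * bSymbol j l * diffSpec φ₁ φ₂ l ^ 2) torusMeasure := by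
  obtain ⟨C, hC⟩ := exists_norm_crossSpec_le hφ₁ hφ₂ hφ₂'
  refine integrable_torusMeasure_of_bound (C := C ^ 2)
    (Measurable.aestronglyMeasurable (by fun_prop)) fun l hl => ?_
  rw [← norm_crossSpec_sq hφ₁ hφ₂, norm_pow, norm_norm]
  exact pow_le_pow_left₀ (norm_nonneg _) (hC i j l hl) 2

/-- `cᵀ Σ c` is twice the integral of the square of `(∑ cᵢ bᵢ) f`. -/
lemma posSemidef_SigmaQ (hφ₁ : 0 < φ₁) (hφ₂ : 0 < φ₂) (hφ₂' : φ₂ < 1) :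
    (SigmaQ φ₁ φ₂).PosSemidef := by
  have hi := integrable_bSymbol_mul_diffSpec_sq hφ₁ hφ₂ hφ₂'
  refine Matrix.PosSemidef.of_dotProduct_mulVec_nonneg ?_ fun c => ?_
  · ext i j
    simp only [SigmaQ, Matrix.conjTranspose_apply, Matrix.of_apply, star_trivial]
    simp_rw [mul_comm (bSymbol j _)]
  · have : star c ⬝ᵥ (SigmaQ φ₁ φ₂).mulVec c =
        2 * ∫ l, (∑ i, c i * bSymbol i l) ^ 2 * diffSpec φ₁ φ₂ l ^ 2 ∂torusMeasure := by
      have h1 : ∀ l, (∑ i, c i * bSymbol i l) ^ 2 * diffSpec φ₁ φ₂ l ^ 2 =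
          ∑ i, ∑ j, c i * c j * (bSymbol i l * bSymbol j l * diffSpec φ₁ φ₂ l ^ 2) := by
        intro l
        rw [sq, Finset.sum_mul_sum, Finset.sum_mul]
        refine Finset.sum_congr rfl fun i _ => ?_
        rw [Finset.sum_mul]
        exact Finset.sum_congr rfl fun j _ => by ring
      simp_rw [h1]
      rw [integral_finsetSum _ fun i _ => integrable_finsetSum _ fun j _ => (hi i j).const_mul _,
        Finset.mul_sum, dotProduct]
      refine Finset.sum_congr rfl fun i _ => ?_
      rw [integral_finsetSum _ fun j _ => (hi i j).const_mul _, Finset.mul_sum, Matrix.mulVec,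
        dotProduct, Finset.mul_sum]
      refine Finset.sum_congr rfl fun j _ => ?_
      rw [integral_const_mul, SigmaQ, Matrix.of_apply]
      simp
      ring
    rw [this]
    exact mul_nonneg (by norm_num) (integral_nonneg fun l => by positivity)

/-- The joint central limit theorem for the quadratic variations. -/
lemma IsPowerLawField.tendstoInDistribution_quadVarVec (hX : IsPowerLawField P X φ₁ φ₂)
    [IsProbabilityMeasure P] (hφ₁ : 0 < φ₁) (hφ₂ : 0 < φ₂) (hφ₂' : φ₂ < 1) :
    TendstoInDistribution
      (fun (n : ℕ) ω => √((n ^ 2 : ℕ) : ℝ) • (quadVarVec X n ω - quadMean φ₁ φ₂))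
      atTop (id : Plane → Plane) (fun _ => P) (multivariateGaussian 0 (SigmaQ φ₁ φ₂)) where
  forall_aemeasurable n := hX.aemeasurable_standardized n
  tendsto := by
    refine ProbabilityMeasure.tendsto_of_tendsto_charFun fun θ => ?_
    simp only [ProbabilityMeasure.coe_mk, Measure.map_id]
    rw [charFun_multivariateGaussian (posSemidef_SigmaQ hφ₁ hφ₂ hφ₂')]
    convert tendsto_charFun_quadVarVec hX hφ₁ hφ₂ hφ₂' θ using 3
    simp [dotProduct, Matrix.mulVec, Fin.sum_univ_two]
    ring

end

/-! ### The delta method -/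

section

variable {Ω Ω' : Type*} [MeasurableSpace Ω] [MeasurableSpace Ω'] {P : Measure Ω}
  [IsProbabilityMeasure P] {μ : Measure Ω'} [IsProbabilityMeasure μ]

/-- Slutsky: `V - q` is `r⁻¹ → 0` times a sequence converging in law, so it tends to 0 in law. The
portmanteau bound on the closed sets `{ε ≤ ‖x‖}` turns this into convergence in measure. -/
lemma tendstoInMeasure_of_tendstoInDistribution_smul {r : ℕ → ℝ} (hr : Tendsto r atTop atTop)
    {V : ℕ → Ω → Plane} {q : Plane} {Z : Ω' → Plane}
    (h : TendstoInDistribution (fun n ω => r n • (V n ω - q)) atTop Z (fun _ => P) μ) :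
    TendstoInMeasure P V atTop fun _ => q := by
  have hc : TendstoInMeasure P (fun n (_ : Ω) => (r n)⁻¹) atTop fun _ => (0 : ℝ) := by
    rw [tendstoInMeasure_iff_norm]
    intro ε hε
    refine tendsto_const_nhds.congr' ?_
    filter_upwards [hr.inv_tendsto_atTop.eventually (Metric.ball_mem_nhds 0 hε)] with n hn
    have : ¬ ε ≤ ‖(r n)⁻¹ - 0‖ := by
      rw [sub_zero, not_le]
      simpa using hn
    rw [Set.eq_empty_of_forall_notMem (s := {x : Ω | ε ≤ ‖(r n)⁻¹ - 0‖}) fun _ => this,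
      measure_empty]
  have h1 := h.continuous_comp_prodMk_of_tendstoInMeasure_const
    (g := fun x : Plane × ℝ => x.2 • x.1) (by fun_prop) hc fun _ => aemeasurable_const
  rw [tendstoInMeasure_iff_norm]
  intro ε hε
  have hF : IsClosed {x : Plane | ε ≤ ‖x‖} := isClosed_le continuous_const continuous_norm
  have h2 := ProbabilityMeasure.limsup_measure_closed_le_of_tendsto h1.tendsto hF
  have h3 : (μ.map fun ω => (0 : ℝ) • Z ω) {x : Plane | ε ≤ ‖x‖} = 0 := by
    simp only [zero_smul]
    rw [Measure.map_apply measurable_const hF.measurableSet,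
      Set.eq_empty_of_forall_notMem (s := (fun _ : Ω' => (0 : Plane)) ⁻¹' {x : Plane | ε ≤ ‖x‖})
        fun _ => by simpa using hε, measure_empty]
  simp only [ProbabilityMeasure.coe_mk] at h2
  rw [h3] at h2
  have h4 : Tendsto (fun n => (P.map fun ω => (r n)⁻¹ • r n • (V n ω - q))
      {x : Plane | ε ≤ ‖x‖}) atTop (𝓝 0) :=
    tendsto_of_le_liminf_of_limsup_le (zero_le) h2
  refine h4.congr' ?_
  filter_upwards [hr.eventually_gt_atTop 0] with n hn
  rw [Measure.map_apply_of_aemeasurable (h1.forall_aemeasurable n) hF.measurableSet]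
  simp only [inv_smul_smul₀ hn.ne']
  rfl

/-- The **delta method**. -/
lemma TendstoInDistribution.delta_method {r : ℕ → ℝ} (hr0 : ∀ n, 0 ≤ r n)
    (hr : Tendsto r atTop atTop) {V : ℕ → Ω → Plane} (hV : ∀ n, AEMeasurable (V n) P) {q : Plane}
    {Z : Ω' → Plane}
    (h : TendstoInDistribution (fun n ω => r n • (V n ω - q)) atTop Z (fun _ => P) μ)
    {g : Plane → Plane} (hg : Measurable g) {L : Plane →L[ℝ] Plane} (hL : HasFDerivAt g L q) :
    TendstoInDistribution (fun n ω => r n • (g (V n ω) - g q)) atTop (fun ω => L (Z ω))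
      (fun _ => P) μ := by
  -- The normalised Taylor remainder tends to 0 at `q` by differentiability, and `0⁻¹ = 0` makes it
  -- 0 there.
  set ρ : Plane → Plane := fun v => ‖v - q‖⁻¹ • (g v - g q - L (v - q)) with hρ
  have hρm : Measurable ρ := by fun_prop
  have hρ0 : Tendsto ρ (𝓝 q) (𝓝 0) := by
    rw [tendsto_zero_iff_norm_tendsto_zero]
    refine (hasFDerivAt_iff_tendsto.1 hL).congr fun v => ?_
    rw [hρ, norm_smul, norm_inv, norm_norm]
  have hVq := tendstoInMeasure_of_tendstoInDistribution_smul hr h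
  have hρV : TendstoInMeasure P (fun n ω => ρ (V n ω)) atTop fun _ => (0 : Plane) := by
    rw [tendstoInMeasure_iff_norm] at hVq ⊢
    intro ε hε
    obtain ⟨δ, hδ, H⟩ := Metric.tendsto_nhds_nhds.1 hρ0 ε hε
    refine tendsto_of_tendsto_of_tendsto_of_le_of_le tendsto_const_nhds (hVq δ hδ)
      (fun _ => zero_le) fun n => measure_mono fun ω hω => ?_
    simp only [Set.mem_ofPred_eq, sub_zero] at hω ⊢
    by_contra hlt
    have := H (x := V n ω) (by rw [dist_eq_norm]; exact not_le.1 hlt)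
    rw [dist_zero_right] at this
    exact absurd hω (not_le.2 this)
  -- With `W = r (V - q)`, the scaled difference is exactly `L W + ‖W‖ ρ(V)`, a continuous function
  -- of the pair `(W, ρ(V))`.
  have h1 := h.continuous_comp_prodMk_of_tendstoInMeasure_const
    (g := fun x : Plane × Plane => L x.1 + ‖x.1‖ • x.2) (by fun_prop) hρV
    fun n => hρm.comp_aemeasurable (hV n)
  refine h1.congr (fun n => ae_of_all _ fun ω => ?_) (ae_of_all _ fun ω => by simp)
  simp only [hρ, norm_smul, Real.norm_of_nonneg (hr0 n), map_smul]
  rcases eq_or_ne (V n ω) q with hq | hq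
  · simp [hq]
  · have : ‖V n ω - q‖ ≠ 0 := norm_ne_zero_iff.2 (sub_ne_zero.2 hq)
    rw [smul_smul, mul_assoc, mul_inv_cancel₀ this, mul_one, smul_sub]
    abel

end

/-! ### The moment map -/

lemma norm_latticePoint_rpow (φ : ℝ) (h : ℤ × ℤ) :
    ‖latticePoint h‖ ^ (2 * φ) = ((h.1 : ℝ) ^ 2 + (h.2 : ℝ) ^ 2) ^ φ := by
  have : ‖latticePoint h‖ ^ (2 : ℕ) = (h.1 : ℝ) ^ 2 + (h.2 : ℝ) ^ 2 := by
    rw [EuclideanSpace.real_norm_sq_eq, Fin.sum_univ_two]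
    simp [latticePoint]
  rw [← this, ← Real.rpow_natCast, ← Real.rpow_mul (norm_nonneg _)]
  norm_num

lemma Gamma_neg_lt_zero {φ : ℝ} (h0 : 0 < φ) (h1 : φ < 1) : Real.Gamma (-φ) < 0 := by
  rw [Gamma_neg_eq h0]
  have : 0 < Real.Gamma (1 - φ) := Real.Gamma_pos_of_pos (by linarith)
  have : 0 < Real.Gamma (1 - φ) / φ := by positivity
  linarith

lemma aOne_pos {φ : ℝ} (h0 : 0 < φ) (h1 : φ < 1) : 0 < aOne φ := by
  have h2 : (2 : ℝ) ^ φ < 2 := by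
    simpa using Real.rpow_lt_rpow_of_exponent_lt (by norm_num : (1 : ℝ) < 2) h1
  exact mul_pos (abs_pos.2 (Gamma_neg_lt_zero h0 h1).ne) (by linarith)

/-- Among ordered pairs of corners of the unit square, 4 coincide, 8 are adjacent with sign `-`, and
4 are diagonal with sign `+`. -/
lemma crossCov_zero_zero {φ₁ φ₂ : ℝ} (hφ₂ : 0 < φ₂) (hφ₂' : φ₂ < 1) :
    crossCov φ₁ φ₂ 0 0 0 = φ₁ * aOne φ₂ := by
  rw [aOne, abs_of_neg (Gamma_neg_lt_zero hφ₂ hφ₂')]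
  simp [crossCov, genCov, norm_latticePoint_rpow, Fintype.sum_prod_type, cornerSign, cornerLag,
    Real.zero_rpow hφ₂.ne']
  norm_num
  ring

/-- Self-similarity: doubling the square multiplies the covariance by `2^(2φ₂)`. This ratio is what
identifies `φ₂`. -/
lemma crossCov_one_one {φ₁ φ₂ : ℝ} (hφ₂ : 0 < φ₂) (hφ₂' : φ₂ < 1) :
    crossCov φ₁ φ₂ 1 1 0 = (2 : ℝ) ^ (2 * φ₂) * (φ₁ * aOne φ₂) := by
  have h4 : (4 : ℝ) ^ φ₂ = (2 : ℝ) ^ (2 * φ₂) := by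
    rw [Real.rpow_mul (by norm_num)]; norm_num
  have h8 : (8 : ℝ) ^ φ₂ = (2 : ℝ) ^ (2 * φ₂) * (2 : ℝ) ^ φ₂ := by
    rw [← h4, ← Real.mul_rpow (by norm_num) (by norm_num)]; norm_num
  rw [aOne, abs_of_neg (Gamma_neg_lt_zero hφ₂ hφ₂')]
  simp [crossCov, genCov, norm_latticePoint_rpow, Fintype.sum_prod_type, cornerSign, cornerLag,
    Real.zero_rpow hφ₂.ne']
  norm_num
  rw [h4, h8]
  ring

lemma half_logb_quadMean {φ₁ φ₂ : ℝ} (hφ₁ : 0 < φ₁) (hφ₂ : 0 < φ₂) (hφ₂' : φ₂ < 1) :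
    1 / 2 * Real.logb 2 (quadMean φ₁ φ₂ 1 / quadMean φ₁ φ₂ 0) = φ₂ := by
  have ha := aOne_pos hφ₂ hφ₂'
  have h : quadMean φ₁ φ₂ 1 / quadMean φ₁ φ₂ 0 = (2 : ℝ) ^ (2 * φ₂) := by
    simp only [quadMean]
    rw [crossCov_zero_zero hφ₂ hφ₂', crossCov_one_one hφ₂ hφ₂']
    field_simp
  rw [h, Real.logb_rpow (by norm_num) (by norm_num)]
  ring

lemma momentMap_quadMean {φ₁ φ₂ : ℝ} (hφ₁ : 0 < φ₁) (hφ₂ : 0 < φ₂) (hφ₂' : φ₂ < 1) :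
    momentMap (quadMean φ₁ φ₂) = !₂[φ₁, φ₂] := by
  rw [momentMap, half_logb_quadMean hφ₁ hφ₂ hφ₂']
  have ha := aOne_pos hφ₂ hφ₂'
  congr 2
  simp only [quadMean]
  rw [crossCov_zero_zero hφ₂ hφ₂']
  field_simp

/-- For `0 < φ < 1`, `-φ` is not a pole of `Γ`, and `Γ(-φ) < 0` keeps the absolute value away from
its kink. -/
lemma differentiableAt_aOne {φ : ℝ} (h0 : 0 < φ) (h1 : φ < 1) : DifferentiableAt ℝ aOne φ := by
  have hG : DifferentiableAt ℝ Real.Gamma (-φ) := by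
    refine Real.differentiableAt_Gamma fun m hm => ?_
    have h2 : φ = m := neg_injective hm
    rw [h2] at h0 h1
    have h3 : 0 < m := by exact_mod_cast h0
    have h4 : m < 1 := by exact_mod_cast h1
    omega
  have h2 : DifferentiableAt ℝ (fun x => Real.Gamma (-x)) φ :=
    DifferentiableAt.comp (f := fun x : ℝ => -x) φ hG differentiableAt_id.neg
  have h3 : DifferentiableAt ℝ (fun x => |Real.Gamma (-x)|) φ :=
    h2.abs (Gamma_neg_lt_zero h0 h1).ne
  have h4 : DifferentiableAt ℝ (fun x : ℝ => 8 - 4 * (2 : ℝ) ^ x) φ :=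
    ((Real.hasStrictDerivAt_const_rpow (by norm_num) φ).hasDerivAt.differentiableAt.const_mul
      4).const_sub 8
  exact h3.mul h4

lemma differentiableAt_momentMap {φ₁ φ₂ : ℝ} (hφ₁ : 0 < φ₁) (hφ₂ : 0 < φ₂) (hφ₂' : φ₂ < 1) :
    DifferentiableAt ℝ momentMap (quadMean φ₁ φ₂) := by
  have ha := aOne_pos hφ₂ hφ₂'
  have hlog := half_logb_quadMean hφ₁ hφ₂ hφ₂'
  have e0 : quadMean φ₁ φ₂ 0 ≠ 0 := by
    simp only [quadMean]
    rw [crossCov_zero_zero hφ₂ hφ₂']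
    positivity
  have e1 : quadMean φ₁ φ₂ 1 ≠ 0 := by
    simp only [quadMean]
    rw [crossCov_one_one hφ₂ hφ₂']
    positivity
  have d0 : ∀ i, DifferentiableAt ℝ (fun y : Plane => y i) (quadMean φ₁ φ₂) := fun i => by
    fun_prop
  have dl : DifferentiableAt ℝ (fun y : Plane => 1 / 2 * Real.logb 2 (y 1 / y 0))
      (quadMean φ₁ φ₂) := by
    simp only [Real.logb, div_eq_mul_inv _ (Real.log 2)]
    have h := (d0 1).fun_mul ((d0 0).fun_inv e0)
    simp only [← div_eq_mul_inv] at h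
    exact ((h.log (div_ne_zero e1 e0)).mul_const _).const_mul _
  have da : DifferentiableAt ℝ (fun y : Plane => aOne (1 / 2 * Real.logb 2 (y 1 / y 0)))
      (quadMean φ₁ φ₂) := by
    refine DifferentiableAt.comp (g := aOne) _ ?_ dl
    rw [hlog]
    exact differentiableAt_aOne hφ₂ hφ₂'
  rw [differentiableAt_euclidean]
  intro i
  fin_cases i
  · refine ((d0 0).fun_mul (da.fun_inv ?_)).congr_of_eventuallyEq
      (Eventually.of_forall fun y => div_eq_mul_inv _ _)
    rw [hlog]
    exact ha.ne'
  · exact dl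

-- `1/Γ` is entire, hence measurable, and inversion preserves measurability; the poles need no
-- separate treatment.
@[fun_prop]
lemma measurable_Gamma : Measurable Real.Gamma := by
  have h : Real.Gamma = fun x : ℝ => (((Complex.Gamma (x : ℂ))⁻¹)⁻¹).re := by
    funext x
    rw [inv_inv, Complex.Gamma_ofReal, Complex.ofReal_re]
  rw [h]
  have := Complex.differentiable_one_div_Gamma.continuous.measurable
  exact Complex.measurable_re.comp ((this.comp Complex.measurable_ofReal).inv)

@[fun_prop]
lemma measurable_aOne : Measurable aOne := by
  unfold aOne
  fun_prop

lemma measurable_momentMap : Measurable momentMap := by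
  refine (WithLp.measurable_toLp 2 _).comp (measurable_pi_lambda _ fun i => ?_)
  simp only [Real.logb]
  fin_cases i
  · simp only [Fin.zero_eta, Matrix.cons_val_zero]
    fun_prop
  · simp only [Fin.mk_one, Matrix.cons_val_one, Matrix.cons_val_fin_one]
    fun_prop

/-! ### Linear images of Gaussian laws -/

lemma map_multivariateGaussian_toEuclideanCLM {S : Matrix (Fin 2) (Fin 2) ℝ} (hS : S.PosSemidef)
    (M : Matrix (Fin 2) (Fin 2) ℝ) :
    (multivariateGaussian 0 S).map (Matrix.toEuclideanCLM (𝕜 := ℝ) M) =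
      multivariateGaussian 0 (M * S * M.transpose) := by
  have hMS : (M * S * M.transpose).PosSemidef := by
    have := hS.mul_mul_conjTranspose_same M
    rwa [Matrix.conjTranspose_eq_transpose_of_trivial] at this
  refine Measure.ext_of_charFun (funext fun t => ?_)
  have h1 : charFun ((multivariateGaussian 0 S).map (Matrix.toEuclideanCLM (𝕜 := ℝ) M)) t =
      charFun (multivariateGaussian 0 S) (WithLp.toLp 2 (M.transpose.mulVec t.ofLp)) := by
    rw [charFun_apply, charFun_apply, integral_map (by fun_prop) (by fun_prop)]
    refine integral_congr_ae (ae_of_all _ fun x => ?_)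
    simp only
    congr 3
    rw [real_inner_comm, Matrix.inner_toEuclideanCLM, EuclideanSpace.inner_eq_star_dotProduct,
      star_trivial, Matrix.mulVec_transpose, Matrix.dotProduct_mulVec]
  rw [h1, charFun_multivariateGaussian hS, charFun_multivariateGaussian hMS]
  simp only [inner_zero_right, Complex.ofReal_zero, zero_mul, zero_sub]
  congr 4
  rw [← Matrix.mulVec_mulVec, ← Matrix.mulVec_mulVec, Matrix.dotProduct_mulVec t.ofLp M,
    Matrix.mulVec_transpose]

lemma fderiv_eq_toEuclideanCLM_jacobian (g : Plane → Plane) (q : Plane) :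
    fderiv ℝ g q = Matrix.toEuclideanCLM (𝕜 := ℝ) (jacobian g q) := by
  refine ContinuousLinearMap.ext fun x => ?_
  have hx : x = ∑ j, x j • EuclideanSpace.single j (1 : ℝ) := by
    ext i
    fin_cases i <;> simp [Fin.sum_univ_two]
  ext i
  rw [Matrix.ofLp_toEuclideanCLM, Matrix.mulVec, dotProduct]
  conv_lhs => rw [hx, map_sum]
  simp only [map_smul, jacobian, Matrix.of_apply]
  simp [Fin.sum_univ_two, mul_comm]

end PowerLaw

/-! ### The limit theorem for the estimators -/

theorem mainTheorem11 {Ω : Type*} [MeasurableSpace Ω] (P : Measure Ω) [IsProbabilityMeasure P]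
    (X : PowerLaw.Plane → Ω → ℝ) (φ₁ φ₂ : ℝ) (hφ₁ : 0 < φ₁) (hφ₂ : 0 < φ₂) (hφ₂' : φ₂ < 1)
    (hX : PowerLaw.IsPowerLawField P X φ₁ φ₂) :
    -- the expectations `q_r` of the quadratic variations exist and do not depend on the grid
    ∃ q : PowerLaw.Plane,
      (∀ (r : Fin 2) (n : ℕ), 2 * (r.val + 1) < n →
        Integrable (fun ω => PowerLaw.quadVar (r.val + 1) n
          (PowerLaw.sample (fun x => X x ω))) P ∧
        ∫ ω, PowerLaw.quadVar (r.val + 1) n (PowerLaw.sample (fun x => X x ω)) ∂P = q r) ∧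
      -- the quantities that define the limit covariance are well defined
      DifferentiableAt ℝ PowerLaw.momentMap q ∧
      (∀ l : PowerLaw.Plane, Summable fun m : ℤ × ℤ =>
        PowerLaw.specDensity φ₁ φ₂ (PowerLaw.shiftFreq l m)) ∧
      (∀ i j : Fin 2, Integrable (fun l => PowerLaw.bSymbol i l * PowerLaw.bSymbol j l *
        PowerLaw.diffSpec φ₁ φ₂ l ^ 2) PowerLaw.torusMeasure) ∧
      (PowerLaw.ratioMat φ₁ * PowerLaw.SigmaH φ₁ φ₂ q *
        (PowerLaw.ratioMat φ₁).transpose).PosSemidef ∧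
      -- the central limit theorem, with `N = n²`
      TendstoInDistribution
        (fun (n : ℕ) (ω : Ω) =>
          (!₂[√((n ^ 2 : ℕ) : ℝ) *
                (PowerLaw.phiOneHat n (PowerLaw.sample (fun x => X x ω)) / φ₁ - 1),
              √((n ^ 2 : ℕ) : ℝ) *
                (PowerLaw.phiTwoHat n (PowerLaw.sample (fun x => X x ω)) - φ₂)] :
            PowerLaw.Plane))
        atTop (id : PowerLaw.Plane → PowerLaw.Plane) (fun _ => P)
        (multivariateGaussian 0 (PowerLaw.ratioMat φ₁ * PowerLaw.SigmaH φ₁ φ₂ q *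
          (PowerLaw.ratioMat φ₁).transpose)) := by
  set q := PowerLaw.quadMean φ₁ φ₂ with hq
  have hS := PowerLaw.posSemidef_SigmaQ hφ₁ hφ₂ hφ₂'
  set M := PowerLaw.ratioMat φ₁ * PowerLaw.jacobian PowerLaw.momentMap q with hM
  have hcov : PowerLaw.ratioMat φ₁ * PowerLaw.SigmaH φ₁ φ₂ q * (PowerLaw.ratioMat φ₁).transpose =
      M * PowerLaw.SigmaQ φ₁ φ₂ * M.transpose := by
    rw [PowerLaw.SigmaH, hM, Matrix.transpose_mul]
    simp only [Matrix.mul_assoc]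
  have hdiff := PowerLaw.differentiableAt_momentMap hφ₁ hφ₂ hφ₂'
  refine ⟨q, fun r n hn => hX.integral_quadVar r hn, hdiff,
    PowerLaw.summable_specDensity_shiftFreq hφ₁ hφ₂,
    PowerLaw.integrable_bSymbol_mul_diffSpec_sq hφ₁ hφ₂ hφ₂', ?_, ?_⟩
  · rw [hcov]
    have := hS.mul_mul_conjTranspose_same M
    rwa [Matrix.conjTranspose_eq_transpose_of_trivial] at this
  · have hr : Tendsto (fun n : ℕ => √((n ^ 2 : ℕ) : ℝ)) atTop atTop := by
      have : (fun n : ℕ => √((n ^ 2 : ℕ) : ℝ)) = fun n : ℕ => (n : ℝ) := by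
        funext n
        push_cast
        exact Real.sqrt_sq (by positivity)
      rw [this]
      exact tendsto_natCast_atTop_atTop
    have h1 := PowerLaw.TendstoInDistribution.delta_method (fun n => Real.sqrt_nonneg _) hr
      hX.aemeasurable_quadVarVec (hX.tendstoInDistribution_quadVarVec hφ₁ hφ₂ hφ₂')
      PowerLaw.measurable_momentMap hdiff.hasFDerivAt
    have h2 := h1.continuous_comp
      (Matrix.toEuclideanCLM (𝕜 := ℝ) (PowerLaw.ratioMat φ₁)).continuous
    -- An exact identity for every `n` and `ω`: estimators and moment map are the same formulas, so
    -- their values agree even where a division or logarithm is degenerate.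
    have hfun : ∀ (n : ℕ) (ω : Ω),
        (!₂[√((n ^ 2 : ℕ) : ℝ) *
                (PowerLaw.phiOneHat n (PowerLaw.sample (fun x => X x ω)) / φ₁ - 1),
              √((n ^ 2 : ℕ) : ℝ) *
                (PowerLaw.phiTwoHat n (PowerLaw.sample (fun x => X x ω)) - φ₂)] :
            PowerLaw.Plane) =
        Matrix.toEuclideanCLM (𝕜 := ℝ) (PowerLaw.ratioMat φ₁) (√((n ^ 2 : ℕ) : ℝ) •
          (PowerLaw.momentMap (PowerLaw.quadVarVec X n ω) - PowerLaw.momentMap q)) := by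
      intro n ω
      rw [hq, PowerLaw.momentMap_quadMean hφ₁ hφ₂ hφ₂']
      ext i
      rw [Matrix.ofLp_toEuclideanCLM, PowerLaw.ratioMat, Matrix.mulVec_diagonal]
      fin_cases i
      · simp [PowerLaw.momentMap, PowerLaw.quadVarVec, PowerLaw.phiOneHat, PowerLaw.phiTwoHat]
        field_simp
      · simp [PowerLaw.momentMap, PowerLaw.quadVarVec, PowerLaw.phiTwoHat]
    have hlaw : (multivariateGaussian 0 (PowerLaw.SigmaQ φ₁ φ₂)).map
        (Matrix.toEuclideanCLM (𝕜 := ℝ) (PowerLaw.ratioMat φ₁) ∘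
          fun x => fderiv ℝ PowerLaw.momentMap q (id x)) =
        multivariateGaussian 0 (PowerLaw.ratioMat φ₁ * PowerLaw.SigmaH φ₁ φ₂ q *
          (PowerLaw.ratioMat φ₁).transpose) := by
      rw [hcov, ← PowerLaw.map_multivariateGaussian_toEuclideanCLM hS]
      congr 1
      funext x
      rw [hM, map_mul, Function.comp_apply, PowerLaw.fderiv_eq_toEuclideanCLM_jacobian]
      rfl
    refine ⟨fun n => (h2.forall_aemeasurable n).congr (ae_of_all _ fun ω => (hfun n ω).symm),
      aemeasurable_id, ?_⟩
    have hd : ∀ n : ℕ, P.map (fun ω => (!₂[√((n ^ 2 : ℕ) : ℝ) *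
                (PowerLaw.phiOneHat n (PowerLaw.sample (fun x => X x ω)) / φ₁ - 1),
              √((n ^ 2 : ℕ) : ℝ) *
                (PowerLaw.phiTwoHat n (PowerLaw.sample (fun x => X x ω)) - φ₂)] :
            PowerLaw.Plane)) = P.map (Matrix.toEuclideanCLM (𝕜 := ℝ) (PowerLaw.ratioMat φ₁) ∘
          fun ω => √((n ^ 2 : ℕ) : ℝ) •
            (PowerLaw.momentMap (PowerLaw.quadVarVec X n ω) - PowerLaw.momentMap q)) :=
      fun n => congrArg (fun f => P.map f) (funext fun ω => hfun n ω)
    have h3 := h2.tendsto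
    refine (h3.congr fun n => Subtype.ext (hd n).symm).trans_eq ?_
    exact congrArg _ (Subtype.ext (hlaw.trans Measure.map_id.symm))
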